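/- Let $\upsilon,b,c,\lambda\in\mathbb C$ and $y>0$ with $\Re\upsilon>0$, $\Re c>0$, with $\Re\lambda>0,\ \Re b>0$ (or $\Re\lambda<0,\ \Re b<0$), and with $\Re(\lambda b)>0$ (automatic if $\lambda,b$ are real). Put $w_k=\lambda b+ck$ for $k=0,1,2,\dots$; powers of $2$ and of $w_k$ are principal. Let $r,s\ge 0$, $\alpha_i,\beta_j\in\mathbb C$, $A_i,B_j\in\mathbb R\setminus\{0\}$ $(1\le i\le r,\ 1\le j\le s)$, where no $\alpha_i+kA_i$ $(k\ge0)$ is a non-positive integer, and let $$\Theta(k)=\frac{\prod_{i=1}^r\Gamma(\alpha_i+kA_i)}{\prod_{j=1}^s\Gamma(\beta_j+kB_j)},\qquad {}_r\Psi_s[z]=\sum_{k=0}^\infty \Theta(k)\frac{z^k}{k!}$$ (with $1/\Gamma=0$ at the poles of $\Gamma$). Assume the convergence condition $$\sum_{k=0}^\infty \frac{|\Theta(k)|}{k!\,(k+1)^{2\Re\upsilon}}<\infty ,$$ which holds in particular whenever the series of ${}_r\Psi_s[z]$ converges absolutely at $z=1$, e.g. for bounded $\Theta$. Then the series of ${}_r\Psi_s[e^{-c\sqrt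 x}]$ converges absolutely for every $x>0$, the integral $$\Xi_C=\int_0^\infty x^{\upsilon-1}e^{-b\lambda\sqrt x}\,{}_r\Psi_s\big[e^{-c\sqrt x}\big]\cos(xy)\,dx$$ converges absolutely, and $$\Xi_C=\sum_{k=0}^\infty\frac{\Theta(k)}{k!}\int_0^\infty x^{\upsilon-1}e^{-w_k\sqrt x}\cos(xy)\,dx$$ $$=\frac{2^{4\upsilon-3/2}}{\pi}\sum_{k=0}^\infty\frac{\Theta(k)}{k!\,w_k^{2\upsilon}}\,G^{1,4}_{4,2}\!\left(\frac{64y^2}{w_k^4}\,\middle|\,\begin{matrix}\frac{4-2\upsilon}4,\frac{3-2\upsilon}4,\frac{2-2\upsilon}4,\frac{1-2\upsilon}4;-\\ 0;\frac12\end{matrix}\right)$$ $$=\frac{\sqrt y\,2^{4\upsilon}}{\pi}\sum_{k=0}^\infty\frac{\Theta(k)}{k!\,w_k^{2\upsilon+1}}\,G^{1,4}_{4,2}\!\left(\frac{64y^2}{w_k^4}\,\middle|\,\begin{matrix}\frac{3-2\upsilon}4,\frac{2-2\upsilon}4,\frac{1-2\upsilon}4,\frac{-2\upsilon}4;-\\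 -\frac14;\frac14\end{matrix}\right)$$ $$=\frac{2^{4\upsilon-9/2}}{\pi y}\sum_{k=0}^\infty\frac{\Theta(k)}{k!\,w_k^{2\upsilon-2}}\,G^{1,4}_{4,2}\!\left(\frac{64y^2}{w_k^4}\,\middle|\,\begin{matrix}\frac{6-2\upsilon}4,\frac{5-2\upsilon}4,\frac{4-2\upsilon}4,\frac{3-2\upsilon}4;-\\ \frac12;1\end{matrix}\right)$$ $$=\frac{y\,2^{4\upsilon+3/2}}{\pi}\sum_{k=0}^\infty\frac{\Theta(k)}{k!\,w_k^{2\upsilon+2}}\,G^{1,4}_{4,2}\!\left(\frac{64y^2}{w_k^4}\,\middle|\,\begin{matrix}\frac{2-2\upsilon}4,\frac{1-2\upsilon}4,\frac{-2\upsilon}4,\frac{-1-2\upsilon}4;-\\ -\frac12;0\end{matrix}\right)$$ $$=\frac{2^{6\upsilon-7/2}}{\pi^3}\sum_{k=0}^\infty\frac{\Theta(k)}{k!\,w_k^{2\upsilon}}\,G^{2,8}_{8,4}\!\left(\frac{4^8y^4}{w_k^8}\,\middle|\,\begin{matrix}\frac{8-2\upsilon}8,\frac{7-2\upsilon}8,\dots,\frac{1-2\upsilon}8;-\\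 0,\frac12;\frac14,\frac34\end{matrix}\right),$$ all series and integrals converging absolutely. Here Meijer's function is $$G^{m,n}_{p,q}\!\left(z\,\middle|\,\begin{matrix}a_1,\dots,a_n;a_{n+1},\dots,a_p\\ b_1,\dots,b_m;b_{m+1},\dots,b_q\end{matrix}\right)=\frac1{2\pi i}\int_{\sigma-i\infty}^{\sigma+i\infty}\frac{\prod_{j\le m}\Gamma(b_j-\zeta)\prod_{j\le n}\Gamma(1-a_j+\zeta)}{\prod_{j>m}\Gamma(1-b_j+\zeta)\prod_{j>n}\Gamma(a_j-\zeta)}\,z^\zeta\,d\zeta$$ along any vertical line having the poles of all $\Gamma(b_j-\zeta)$, $j\le m$, on its right and those of all $\Gamma(1-a_j+\zeta)$, $j\le n$, on its left (such lines exist here, and the integral converges absolutely and does not depend on the line), and $\arg(64y^2/w_k^4)=-4\arg w_k\in(-2\pi,2\pi)$, $\arg(4^8y^4/w_k^8)=-8\arg w_k\in(-4\pi,4\pi)$ with $|\arg w_k|<\pi/2$. In particular, with no further convergence assumption, the same conclusions hold (with ${}_r\Psi_s[e^{-c\sqrt x}]$ replaced by the kernel named) for the following kernels with $\beta,\nu\in\mathbb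 C$ and $a,\mu>0$: the Wright function $\Phi(a,\beta,e^{-c\sqrt x})=\sum_k\frac{e^{-ck\sqrt x}}{\Gamma(\beta+ak)\,k!}$, with $\Theta(k)=1/\Gamma(\beta+ak)$; the Wright generalized Bessel kernel $J_\nu^\mu(-e^{-c\sqrt x})=\Phi(\mu,\nu+1,-e^{-c\sqrt x})$, with $\Theta(k)=(-1)^k/\Gamma(\nu+1+\mu k)$; and the Mittag-Leffler function $E_{a,\beta}(e^{-c\sqrt x})=\sum_k\frac{e^{-ck\sqrt x}}{\Gamma(\beta+ak)}$, with $\Theta(k)=k!/\Gamma(\beta+ak)$. -/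

import Mathlib

open MeasureTheory Set

noncomputable section

namespace RamanujanCosine

/-! ### Meijer's G-function -/

/-- The Mellin-Barnes integrand of Meijer's `G^{m,n}_{p,q}`. The upper parameters are
`a₁ = [α₁,…,αₙ]` and `a₂ = [αₙ₊₁,…,α_p]`, the lower ones `b₁ = [β₁,…,βₘ]` and
`b₂ = [βₘ₊₁,…,β_q]`. The variable `z ≠ 0` lives on the Riemann surface of the logarithm (in the
sector of convergence `|arg z|` may exceed `π`); it is given by its logarithm `ℓ`, so that
`z ^ ζ = exp (ζ * ℓ)` and `arg z = ℓ.im`.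
`Complex.Gamma` is `0` at its poles and `x / 0 = 0`, so `1 / Γ` has there its true value `0`. -/
def meijerIntegrand (a₁ a₂ b₁ b₂ : List ℂ) (ℓ ζ : ℂ) : ℂ :=
  ((b₁.map fun β => Complex.Gamma (β - ζ)).prod *
      (a₁.map fun α => Complex.Gamma (1 - α + ζ)).prod) /
    ((b₂.map fun β => Complex.Gamma (1 - β + ζ)).prod *
      (a₂.map fun α => Complex.Gamma (α - ζ)).prod) *
    Complex.exp (ζ * ℓ)

/-- The upward vertical line `Re ζ = σ` has the poles `β + ℕ` of all `Γ(β - ζ)`, `β ∈ b₁`, on its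
right and the poles `α - 1 - ℕ` of all `Γ(1 - α + ζ)`, `α ∈ a₁`, on its left. -/
def SeparatesPoles (a₁ b₁ : List ℂ) (σ : ℝ) : Prop :=
  (∀ β ∈ b₁, σ < β.re) ∧ ∀ α ∈ a₁, α.re - 1 < σ

/-- `1/(2πi)` times the integral of the Mellin-Barnes integrand along the line `Re ζ = σ`,
`ζ = σ + i t`, `dζ = i dt`. -/
def meijerLineIntegral (a₁ a₂ b₁ b₂ : List ℂ) (ℓ : ℂ) (σ : ℝ) : ℂ :=
  1 / (2 * (Real.pi : ℂ) * Complex.I) *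
    ∫ t : ℝ, meijerIntegrand a₁ a₂ b₁ b₂ ℓ ((σ : ℂ) + (t : ℂ) * Complex.I) * Complex.I

open Classical in
/-- Meijer's G-function at `z = exp ℓ`, for parameters whose two families of poles can be separated
by a vertical line: the Mellin-Barnes integral along such a line. -/
def meijerG (a₁ a₂ b₁ b₂ : List ℂ) (ℓ : ℂ) : ℂ :=
  if h : ∃ σ : ℝ, SeparatesPoles a₁ b₁ σ then
    meijerLineIntegral a₁ a₂ b₁ b₂ ℓ h.choose
  else 0

/-- The G-function is well defined at `z = exp ℓ`: a separating vertical line exists, and along every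
separating vertical line the Mellin-Barnes integral converges absolutely to the value of `G`. -/
def MeijerGConverges (a₁ a₂ b₁ b₂ : List ℂ) (ℓ : ℂ) : Prop :=
  (∃ σ : ℝ, SeparatesPoles a₁ b₁ σ) ∧
    ∀ σ : ℝ, SeparatesPoles a₁ b₁ σ →
      Integrable (fun t : ℝ =>
        meijerIntegrand a₁ a₂ b₁ b₂ ℓ ((σ : ℂ) + (t : ℂ) * Complex.I)) ∧
      meijerLineIntegral a₁ a₂ b₁ b₂ ℓ σ = meijerG a₁ a₂ b₁ b₂ ℓ

/-- Upper parameters `(N - 2υ)/4, (N-1 - 2υ)/4, (N-2 - 2υ)/4, (N-3 - 2υ)/4`. -/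
def upper4 (N υ : ℂ) : List ℂ :=
  [(N - 2 * υ) / 4, (N - 1 - 2 * υ) / 4, (N - 2 - 2 * υ) / 4, (N - 3 - 2 * υ) / 4]

/-- Upper parameters `(8 - 2υ)/8, (7 - 2υ)/8, …, (1 - 2υ)/8`. -/
def upper8 (υ : ℂ) : List ℂ :=
  [(8 - 2 * υ) / 8, (7 - 2 * υ) / 8, (6 - 2 * υ) / 8, (5 - 2 * υ) / 8,
    (4 - 2 * υ) / 8, (3 - 2 * υ) / 8, (2 - 2 * υ) / 8, (1 - 2 * υ) / 8]

/-- The logarithm of `64 y² / w⁴`, with argument `-4 arg w`. -/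
def log4 (y : ℝ) (w : ℂ) : ℂ := (Real.log (64 * y ^ 2) : ℂ) - 4 * Complex.log w

/-- The logarithm of `4⁸ y⁴ / w⁸`, with argument `-8 arg w`. -/
def log8 (y : ℝ) (w : ℂ) : ℂ := (Real.log (4 ^ 8 * y ^ 4) : ℂ) - 8 * Complex.log w

/-- `G^{1,4}_{4,2}(64y²/w⁴ | (N-2υ)/4, (N-1-2υ)/4, (N-2-2υ)/4, (N-3-2υ)/4; — | β₁; β₂)`. -/
def G42 (N υ β₁ β₂ : ℂ) (y : ℝ) (w : ℂ) : ℂ :=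
  meijerG (upper4 N υ) [] [β₁] [β₂] (log4 y w)

/-- `G^{2,8}_{8,4}(4⁸y⁴/w⁸ | (8-2υ)/8, (7-2υ)/8, …, (1-2υ)/8; — | 0, 1/2; 1/4, 3/4)`. -/
def G84 (υ : ℂ) (y : ℝ) (w : ℂ) : ℂ :=
  meijerG (upper8 υ) [] [0, 1 / 2] [1 / 4, 3 / 4] (log8 y w)

/-! ### The G-function series of a generalized Ramanujan integral -/

/-- `I` equals `∑ₖ Θ(k)/k! ∫₀^∞ x^{υ-1} e^{-(λb+ck)√x} cos(xy) dx` and equals each of the five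
series of G-functions with the coefficients `Θ(k)`. All integrals and series that occur converge
absolutely. -/
structure HasGSeries (Θ : ℕ → ℂ) (υ b c lam : ℂ) (y : ℝ) (I : ℂ) : Prop where
  integrable_term : ∀ k : ℕ, IntegrableOn (fun x : ℝ =>
    (x : ℂ) ^ (υ - 1) * Complex.exp (-(lam * b + c * k) * (Real.sqrt x : ℂ)) *
      (Real.cos (x * y) : ℂ)) (Ioi 0)
  summable_termwise : Summable fun k : ℕ => Θ k / (k.factorial : ℂ) * ∫ x in Ioi (0 : ℝ),
    (x : ℂ) ^ (υ - 1) * Complex.exp (-(lam * b + c * k) * (Real.sqrt x : ℂ)) *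
      (Real.cos (x * y) : ℂ)
  eq_termwise : I = ∑' k : ℕ, Θ k / (k.factorial : ℂ) * ∫ x in Ioi (0 : ℝ),
    (x : ℂ) ^ (υ - 1) * Complex.exp (-(lam * b + c * k) * (Real.sqrt x : ℂ)) *
      (Real.cos (x * y) : ℂ)
  converges₁ : ∀ k : ℕ,
    MeijerGConverges (upper4 4 υ) [] [0] [1 / 2] (log4 y (lam * b + c * k))
  summable₁ : Summable fun k : ℕ =>
    Θ k / ((k.factorial : ℂ) * (lam * b + c * k) ^ (2 * υ)) *
      G42 4 υ 0 (1 / 2) y (lam * b + c * k)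
  eq₁ : I = (2 : ℂ) ^ (4 * υ - 3 / 2) / (Real.pi : ℂ) * ∑' k : ℕ,
    Θ k / ((k.factorial : ℂ) * (lam * b + c * k) ^ (2 * υ)) *
      G42 4 υ 0 (1 / 2) y (lam * b + c * k)
  converges₂ : ∀ k : ℕ,
    MeijerGConverges (upper4 3 υ) [] [-1 / 4] [1 / 4] (log4 y (lam * b + c * k))
  summable₂ : Summable fun k : ℕ =>
    Θ k / ((k.factorial : ℂ) * (lam * b + c * k) ^ (2 * υ + 1)) *
      G42 3 υ (-1 / 4) (1 / 4) y (lam * b + c * k)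
  eq₂ : I = (Real.sqrt y : ℂ) * (2 : ℂ) ^ (4 * υ) / (Real.pi : ℂ) * ∑' k : ℕ,
    Θ k / ((k.factorial : ℂ) * (lam * b + c * k) ^ (2 * υ + 1)) *
      G42 3 υ (-1 / 4) (1 / 4) y (lam * b + c * k)
  converges₃ : ∀ k : ℕ,
    MeijerGConverges (upper4 6 υ) [] [1 / 2] [1] (log4 y (lam * b + c * k))
  summable₃ : Summable fun k : ℕ =>
    Θ k / ((k.factorial : ℂ) * (lam * b + c * k) ^ (2 * υ - 2)) *
      G42 6 υ (1 / 2) 1 y (lam * b + c * k)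
  eq₃ : I = (2 : ℂ) ^ (4 * υ - 9 / 2) / ((Real.pi : ℂ) * (y : ℂ)) * ∑' k : ℕ,
    Θ k / ((k.factorial : ℂ) * (lam * b + c * k) ^ (2 * υ - 2)) *
      G42 6 υ (1 / 2) 1 y (lam * b + c * k)
  converges₄ : ∀ k : ℕ,
    MeijerGConverges (upper4 2 υ) [] [-1 / 2] [0] (log4 y (lam * b + c * k))
  summable₄ : Summable fun k : ℕ =>
    Θ k / ((k.factorial : ℂ) * (lam * b + c * k) ^ (2 * υ + 2)) *
      G42 2 υ (-1 / 2) 0 y (lam * b + c * k)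
  eq₄ : I = (y : ℂ) * (2 : ℂ) ^ (4 * υ + 3 / 2) / (Real.pi : ℂ) * ∑' k : ℕ,
    Θ k / ((k.factorial : ℂ) * (lam * b + c * k) ^ (2 * υ + 2)) *
      G42 2 υ (-1 / 2) 0 y (lam * b + c * k)
  converges₅ : ∀ k : ℕ,
    MeijerGConverges (upper8 υ) [] [0, 1 / 2] [1 / 4, 3 / 4] (log8 y (lam * b + c * k))
  summable₅ : Summable fun k : ℕ =>
    Θ k / ((k.factorial : ℂ) * (lam * b + c * k) ^ (2 * υ)) *
      G84 υ y (lam * b + c * k)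
  eq₅ : I = (2 : ℂ) ^ (6 * υ - 7 / 2) / (Real.pi : ℂ) ^ 3 * ∑' k : ℕ,
    Θ k / ((k.factorial : ℂ) * (lam * b + c * k) ^ (2 * υ)) *
      G84 υ y (lam * b + c * k)

/-- The Fourier cosine transform at `y` of `x^{υ-1} e^{-bλ√x} K(x)`. -/
def cosTransform (υ b lam : ℂ) (K : ℝ → ℂ) (y : ℝ) : ℂ :=
  ∫ x in Ioi (0 : ℝ), (x : ℂ) ^ (υ - 1) * Complex.exp (-(b * lam) * (Real.sqrt x : ℂ)) *
    K x * (Real.cos (x * y) : ℂ)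

/-- The kernel `K` is given by the (absolutely convergent) series `∑ₖ Θ(k)/k! (e^{-c√x})^k`, the
cosine transform of `x^{υ-1} e^{-bλ√x} K(x)` at `y` converges absolutely, and its value is the sum of
each of the G-function series with coefficients `Θ(k)`. -/
structure TransformHasGSeries (Θ : ℕ → ℂ) (K : ℝ → ℂ) (υ b c lam : ℂ) (y : ℝ) : Prop where
  hasSum_kernel : ∀ x : ℝ, 0 < x → HasSum (fun k : ℕ =>
    Θ k / (k.factorial : ℂ) * Complex.exp (-c * (Real.sqrt x : ℂ)) ^ k) (K x)
  integrable : IntegrableOn (fun x : ℝ =>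
    (x : ℂ) ^ (υ - 1) * Complex.exp (-(b * lam) * (Real.sqrt x : ℂ)) *
      K x * (Real.cos (x * y) : ℂ)) (Ioi 0)
  hasGSeries : HasGSeries Θ υ b c lam y (cosTransform υ b lam K y)

/-! ### The Fox-Wright function and its special cases -/

/-- `∏ᵢ Γ(αᵢ + k Aᵢ) / ∏ⱼ Γ(βⱼ + k Bⱼ)`, where `1 / Γ` is `0` at the poles of `Γ`. -/
def foxWrightCoeff {r s : ℕ} (α : Fin r → ℂ) (A : Fin r → ℝ) (β : Fin s → ℂ) (B : Fin s → ℝ)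
    (k : ℕ) : ℂ :=
  (∏ i, Complex.Gamma (α i + k * (A i : ℂ))) / ∏ j, Complex.Gamma (β j + k * (B j : ℂ))

/-- The Fox-Wright function `ᵣΨₛ[(α₁,A₁),…,(αᵣ,Aᵣ); (β₁,B₁),…,(βₛ,Bₛ); z]`. -/
def foxWright {r s : ℕ} (α : Fin r → ℂ) (A : Fin r → ℝ) (β : Fin s → ℂ) (B : Fin s → ℝ)
    (z : ℂ) : ℂ :=
  ∑' k : ℕ, foxWrightCoeff α A β B k * (z ^ k / (k.factorial : ℂ))

/-- `Ξ_C(υ,b,c,λ,y)`: the cosine transform with kernel `ᵣΨₛ[e^{-c√x}]`. -/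
def XiC {r s : ℕ} (α : Fin r → ℂ) (A : Fin r → ℝ) (β : Fin s → ℂ) (B : Fin s → ℝ)
    (υ b c lam : ℂ) (y : ℝ) : ℂ :=
  cosTransform υ b lam
    (fun x => foxWright α A β B (Complex.exp (-c * (Real.sqrt x : ℂ)))) y

/-- The Wright function `Φ(a, β, z) = ∑ₖ z^k / (Γ(β + a k) k!)`. -/
def wrightPhi (a : ℝ) (β z : ℂ) : ℂ :=
  ∑' k : ℕ, 1 / Complex.Gamma (β + a * k) * (z ^ k / (k.factorial : ℂ))

/-- The Wright generalized Bessel function, normalized by `J^μ_ν(-z) = Φ(μ, ν + 1, -z)`. -/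
def wrightBessel (μ : ℝ) (ν z : ℂ) : ℂ := wrightPhi μ (ν + 1) z

/-- The two-parameter Mittag-Leffler function `E_{a,β}(z) = ∑ₖ z^k / Γ(β + a k)`. -/
def mittagLeffler (a : ℝ) (β z : ℂ) : ℂ :=
  ∑' k : ℕ, z ^ k / Complex.Gamma (β + a * k)

theorem wrightPhi_eq_foxWright (a : ℝ) (β z : ℂ) :
    wrightPhi a β z = foxWright ![] ![] ![β] ![a] z := by
  simp [wrightPhi, foxWright, foxWrightCoeff, mul_comm]

theorem mittagLeffler_eq_foxWright (a : ℝ) (β z : ℂ) :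
    mittagLeffler a β z = foxWright ![1] ![1] ![β] ![a] z := by
  unfold mittagLeffler foxWright foxWrightCoeff
  congr 1
  funext k
  have h : (k.factorial : ℂ) ≠ 0 := by exact_mod_cast k.factorial_ne_zero
  have hG : Complex.Gamma (1 + (k : ℂ)) = k.factorial := by
    rw [add_comm, Complex.Gamma_nat_eq_factorial]
  simp only [Fin.prod_univ_one, Matrix.cons_val_fin_one, Complex.ofReal_one, mul_one, hG]
  rw [mul_comm (k : ℂ) (a : ℂ), div_mul_div_comm, mul_comm (k.factorial : ℂ),
    mul_div_mul_right _ _ h]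

end RamanujanCosine

end

open RamanujanCosine

open Filter Topology

namespace RamanujanCosine

/-! Each term is a Mellin-Barnes integral, and the five G-functions are that integral after Gamma
identities and affine changes of variable. For `Re w > 0`, write `exp (-w √x)` as an inverse Mellin
transform of `Γ(s) w^(-s)`. Against `x^(υ-1) exp (-p x)` with `Re p > 0`, Fubini and the Laplace
transform of a power give the integrand `Γ(s) w^(-s) Γ(υ - s/2) p^(-(υ - s/2))` on `0 < Re s < 2 Re
υ` (`laplace_sqrt_eq_barnes`). Since `|arg w| < π/2`, `Γ(s) w^(-s)` has exponential decay to spare,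
so the bound `exists_norm_barnes_le` survives up to `Re p = 0`; letting `p → ± i y` and averaging
yields the cosine transform (`integral_cos_sqrt_eq_barnes`). The substitution `s = 4ζ + 2υ`, with
the duplication and reflection formulas, turns this integrand into that of the first G-function
(`meijerIntegrand_upper4_eq`). Translating `ζ` gives the next three, and doubling `ζ` with six more
duplications gives `G84` (`meijerIntegrand_upper8_eq`). No contour is ever moved: the cosine
integral is the same for every admissible line. The sum over `k` is exchanged with the integral
because the absolute integral of the `k`-th term is at most a constant times `|Θ k| / (k! (k+1)^(2
Re υ))`. For the special kernels this is summable since `1/Γ` decays geometrically along horizontal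
rays. -/

/-! ### The Laplace transform of a power in the right half-plane -/

theorem continuousOn_cpow_const_Ioi (a : ℂ) : ContinuousOn (fun x : ℝ => (x : ℂ) ^ a) (Ioi 0) :=
  fun _ hx => (Complex.continuousAt_ofReal_cpow_const _ _ (Or.inr (ne_of_gt hx))).continuousWithinAt

theorem norm_cpow_sub_one_mul_exp {a r : ℂ} {x : ℝ} (hx : 0 < x) :
    ‖(x : ℂ) ^ (a - 1) * Complex.exp (-(r * x))‖ = x ^ (a.re - 1) * Real.exp (-r.re * x) := by
  rw [norm_mul, Complex.norm_cpow_eq_rpow_re_of_pos hx, Complex.norm_exp]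
  simp

theorem integrableOn_rpow_mul_exp_neg_mul {a r : ℝ} (ha : 0 < a) (hr : 0 < r) :
    IntegrableOn (fun x : ℝ => x ^ (a - 1) * Real.exp (-r * x)) (Ioi 0) := by
  simpa using integrableOn_rpow_mul_exp_neg_mul_rpow (p := 1) (s := a - 1) (b := r)
    (by linarith) one_pos hr

theorem integrableOn_cpow_mul_exp_neg_mul {a r : ℂ} (ha : 0 < a.re) (hr : 0 < r.re) :
    IntegrableOn (fun x : ℝ => (x : ℂ) ^ (a - 1) * Complex.exp (-(r * x))) (Ioi 0) := by
  refine (integrableOn_rpow_mul_exp_neg_mul ha hr).mono' ?_ ?_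
  · exact ((continuousOn_cpow_const_Ioi _).mul (by fun_prop)).aestronglyMeasurable measurableSet_Ioi
  · filter_upwards [ae_restrict_mem measurableSet_Ioi] with x hx
    rw [norm_cpow_sub_one_mul_exp hx]

theorem differentiableAt_laplace_cpow {a r : ℂ} (ha : 0 < a.re) (hr : 0 < r.re) :
    DifferentiableAt ℂ (fun r : ℂ => ∫ x : ℝ in Ioi 0,
      (x : ℂ) ^ (a - 1) * Complex.exp (-(r * x))) r := by
  -- On this half-plane the differentiated integrand, with its extra factor `x`, has one integrable
  -- majorant.
  have hs : {z : ℂ | r.re / 2 < z.re} ∈ 𝓝 r :=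
    (isOpen_lt continuous_const Complex.continuous_re).mem_nhds (by simp; linarith)
  refine (hasDerivAt_integral_of_dominated_loc_of_deriv_le (μ := volume.restrict (Ioi (0 : ℝ)))
    (F' := fun z (x : ℝ) => (x : ℂ) ^ (a - 1) * (Complex.exp (-(z * x)) * (-x)))
    (bound := fun x => x ^ (a.re + 1 - 1) * Real.exp (-(r.re / 2) * x)) hs ?_ ?_ ?_ ?_ ?_ ?_).2.differentiableAt
  · refine Eventually.of_forall fun z => ?_
    exact ((continuousOn_cpow_const_Ioi _).mul (by fun_prop)).aestronglyMeasurable measurableSet_Ioi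
  · exact integrableOn_cpow_mul_exp_neg_mul ha hr
  · exact ((continuousOn_cpow_const_Ioi _).mul (by fun_prop)).aestronglyMeasurable measurableSet_Ioi
  · filter_upwards [ae_restrict_mem measurableSet_Ioi] with x hx z hz
    have hx' : (0 : ℝ) < x := hx
    rw [← mul_assoc, norm_mul, norm_cpow_sub_one_mul_exp hx', norm_neg, Complex.norm_real,
      Real.norm_of_nonneg hx'.le, mul_right_comm, ← Real.rpow_add_one hx'.ne']
    rw [show a.re - 1 + 1 = a.re + 1 - 1 by ring]
    gcongr
  · exact integrableOn_rpow_mul_exp_neg_mul (by linarith) (by linarith)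
  · filter_upwards with x z hz
    refine HasDerivAt.const_mul _ (HasDerivAt.cexp ?_)
    have := ((hasDerivAt_id z).mul_const (x : ℂ)).neg
    rw [one_mul] at this
    exact this

/-- The Laplace transform of `x ^ (a - 1)` in the right half-plane. -/
theorem integral_cpow_mul_exp_neg_mul {a r : ℂ} (ha : 0 < a.re) (hr : 0 < r.re) :
    ∫ x : ℝ in Ioi 0, (x : ℂ) ^ (a - 1) * Complex.exp (-(r * x)) =
      Complex.Gamma a * r ^ (-a) := by
  have hopen : IsOpen {z : ℂ | 0 < z.re} := isOpen_lt continuous_const Complex.continuous_re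
  have h1 : AnalyticOnNhd ℂ (fun r : ℂ => ∫ x : ℝ in Ioi 0,
      (x : ℂ) ^ (a - 1) * Complex.exp (-(r * x))) {z : ℂ | 0 < z.re} :=
    DifferentiableOn.analyticOnNhd
      (fun z hz => (differentiableAt_laplace_cpow ha hz).differentiableWithinAt) hopen
  have h2 : AnalyticOnNhd ℂ (fun r : ℂ => Complex.Gamma a * r ^ (-a)) {z : ℂ | 0 < z.re} := by
    refine DifferentiableOn.analyticOnNhd (fun z hz => ?_) hopen
    exact ((differentiableAt_id.cpow_const (Or.inl hz)).const_mul _).differentiableWithinAt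
  -- Identity theorem: both sides are analytic and agree at the real points `1 + 1/(n+1)`, which
  -- accumulate at `1`.
  refine h1.eqOn_of_preconnected_of_frequently_eq h2
    (convex_halfSpace_re_gt 0).isPreconnected (z₀ := 1) (by simp) ?_ hr
  have ht : Tendsto (fun n : ℕ => ((1 + 1 / ((n : ℝ) + 1) : ℝ) : ℂ)) atTop (𝓝[≠] 1) := by
    refine tendsto_nhdsWithin_iff.2 ⟨?_, Eventually.of_forall fun n => ?_⟩
    · have := (tendsto_one_div_add_atTop_nhds_zero_nat (𝕜 := ℝ)).const_add 1
      rw [add_zero] at this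
      exact (Complex.continuous_ofReal.tendsto 1).comp this
    · have : (0 : ℝ) < 1 / ((n : ℝ) + 1) := by positivity
      simp only [mem_compl_iff, mem_singleton_iff]
      intro h
      have h' : (1 + 1 / ((n : ℝ) + 1) : ℝ) = 1 := by exact_mod_cast h
      linarith
  refine ht.frequently (Eventually.frequently (Eventually.of_forall fun n => ?_))
  have hpos : (0 : ℝ) < 1 + 1 / ((n : ℝ) + 1) := by positivity
  rw [Complex.integral_cpow_mul_exp_neg_mul_Ioi ha hpos, mul_comm, one_div, Complex.inv_cpow,
    Complex.cpow_neg]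
  rw [Complex.arg_ofReal_of_nonneg hpos.le]
  exact Real.pi_pos.ne

/-! ### Exponential decay of Mellin-Barnes integrands -/

theorem norm_cpow_neg_of_ne_zero {z : ℂ} (hz : z ≠ 0) (s : ℂ) :
    ‖z ^ (-s)‖ = ‖z‖ ^ (-s.re) * Real.exp (z.arg * s.im) := by
  rw [Complex.norm_cpow_of_ne_zero hz, div_eq_mul_inv, ← Real.exp_neg]
  simp

/-- Exponential decay of `Γ` along a vertical line, at every rate below `π / 2`. -/
theorem exists_norm_Gamma_le {σ θ : ℝ} (hσ : 0 < σ) (h0 : 0 ≤ θ) (hθ : θ < Real.pi / 2) :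
    ∃ C : ℝ, 0 ≤ C ∧ ∀ s : ℂ, s.re = σ →
      ‖Complex.Gamma s‖ ≤ C * Real.exp (-θ * |s.im|) := by
  -- Evaluate the Laplace transform at `r = exp (iφ)`: `|r^(-s)| = exp (φ Im s)`, while the integral
  -- is bounded in terms of `Re s` and `cos φ` alone. Choosing `φ = ± θ` by the sign of `Im s` gives
  -- the decay.
  have key : ∀ φ : ℝ, |φ| < Real.pi / 2 → ∀ s : ℂ, s.re = σ →
      ‖Complex.Gamma s‖ ≤
        (∫ x : ℝ in Ioi 0, x ^ (σ - 1) * Real.exp (-Real.cos φ * x)) * Real.exp (-φ * s.im) := by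
    intro φ hφ s hs
    obtain ⟨hφ1, hφ2⟩ := abs_lt.1 hφ
    set r : ℂ := Complex.exp (φ * Complex.I) with hr
    have hre : r.re = Real.cos φ := Complex.exp_ofReal_mul_I_re φ
    have hcos : 0 < Real.cos φ := Real.cos_pos_of_mem_Ioo ⟨by linarith, hφ2⟩
    have hnorm : ‖r‖ = 1 := Complex.norm_exp_ofReal_mul_I φ
    have harg : r.arg = φ := by
      rw [hr, Complex.arg_exp_mul_I, toIocMod_eq_self]
      constructor <;> linarith
    have hr0 : r ≠ 0 := Complex.exp_ne_zero _
    have h := integral_cpow_mul_exp_neg_mul (a := s) (r := r) (hs ▸ hσ) (hre ▸ hcos)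
    have h2 := norm_integral_le_integral_norm (μ := volume.restrict (Ioi (0 : ℝ)))
      fun x : ℝ => (x : ℂ) ^ (s - 1) * Complex.exp (-(r * x))
    rw [h, norm_mul, norm_cpow_neg_of_ne_zero hr0, hnorm, harg, Real.one_rpow, one_mul,
      setIntegral_congr_fun measurableSet_Ioi
        (fun x hx => norm_cpow_sub_one_mul_exp (a := s) (r := r) hx), hre, hs] at h2
    calc ‖Complex.Gamma s‖ = ‖Complex.Gamma s‖ * Real.exp (φ * s.im) * Real.exp (-φ * s.im) := by
          rw [mul_assoc, ← Real.exp_add]; simp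
      _ ≤ _ := by gcongr
  refine ⟨∫ x : ℝ in Ioi 0, x ^ (σ - 1) * Real.exp (-Real.cos θ * x), ?_, fun s hs => ?_⟩
  · refine setIntegral_nonneg measurableSet_Ioi fun x hx => ?_
    have : (0 : ℝ) < x := hx
    positivity
  · rcases le_total 0 s.im with h | h
    · rw [abs_of_nonneg h]
      exact key θ (by rwa [abs_of_nonneg h0]) s hs
    · have := key (-θ) (by rwa [abs_neg, abs_of_nonneg h0]) s hs
      rw [abs_of_nonpos h]
      simpa using this

theorem integrable_exp_neg_mul_abs {δ : ℝ} (hδ : 0 < δ) :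
    Integrable fun t : ℝ => Real.exp (-δ * |t|) := by
  rw [← integrableOn_univ, ← Iic_union_Ioi (a := (0 : ℝ)), integrableOn_union]
  constructor
  · refine (integrableOn_exp_mul_Iic hδ 0).congr_fun (fun x hx => ?_) measurableSet_Iic
    simp [abs_of_nonpos (show x ≤ 0 from hx)]
  · refine (integrableOn_exp_mul_Ioi (neg_lt_zero.2 hδ) 0).congr_fun (fun x hx => ?_)
      measurableSet_Ioi
    simp [abs_of_pos (show 0 < x from hx)]

/-- The constant `C` depends only on `σ` and `θ`; this uniformity in `p` is what permits the later
limit onto the imaginary axis. -/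
theorem exists_norm_Gamma_mul_cpow_le {σ θ : ℝ} (hσ : 0 < σ) (h0 : 0 ≤ θ) (hθ : θ < Real.pi / 2) :
    ∃ C : ℝ, 0 ≤ C ∧ ∀ p : ℂ, p ≠ 0 → ∀ s : ℂ, s.re = σ →
      ‖Complex.Gamma s * p ^ (-s)‖ ≤ C * ‖p‖ ^ (-σ) * Real.exp ((|p.arg| - θ) * |s.im|) := by
  obtain ⟨C, hC, h⟩ := exists_norm_Gamma_le hσ h0 hθ
  refine ⟨C, hC, fun p hp s hs => ?_⟩
  rw [norm_mul, norm_cpow_neg_of_ne_zero hp, hs]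
  calc _ ≤ C * Real.exp (-θ * |s.im|) * (‖p‖ ^ (-σ) * Real.exp (|p.arg| * |s.im|)) := by
        have : p.arg * s.im ≤ |p.arg| * |s.im| := by rw [← abs_mul]; exact le_abs_self _
        have := h s hs
        gcongr
    _ = _ := by
        rw [sub_mul, sub_eq_neg_add, Real.exp_add, ← neg_mul]; ring

/-- The Mellin-Barnes integrand of the Laplace transform of `x ^ (υ - 1) * exp (-w √x)` at `p` has
exponential decay, uniformly for `p` in the closed right half-plane away from the origin. -/
theorem exists_norm_barnes_le {υ w : ℂ} {σ y : ℝ} (hw : 0 < w.re) (hσ : 0 < σ)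
    (hσ' : σ < 2 * υ.re) (hy : 0 < y) :
    ∃ C δ : ℝ, 0 < δ ∧ ∀ p : ℂ, y ≤ ‖p‖ → 0 ≤ p.re → ∀ s : ℂ, s.re = σ →
      ‖Complex.Gamma s * w ^ (-s) * (Complex.Gamma (υ - s / 2) * p ^ (-(υ - s / 2)))‖ ≤
        C * Real.exp (-δ * |s.im|) := by
  have hw0 : w ≠ 0 := by rintro rfl; simp at hw
  have hφ : |w.arg| < Real.pi / 2 := Complex.abs_arg_lt_pi_div_two_iff.2 (Or.inl hw)
  have hφ0 := abs_nonneg w.arg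
  set φ := |w.arg| with hφdef
  -- With the midpoint, `Γ(s) w^(-s)` decays at rate `(π/2 - φ)/2`, while the factor in `p` can grow
  -- at rate at most `(π/2 - θ)/2 = (π/2 - φ)/4`, as its argument contains only `s/2`. The net decay
  -- rate is `(π/2 - φ)/4`.
  set θ := (φ + Real.pi / 2) / 2 with hθdef
  have hθ : θ < Real.pi / 2 := by rw [hθdef]; linarith
  have hθ0 : 0 ≤ θ := by have := Real.pi_pos; positivity
  obtain ⟨C₁, hC₁, h₁⟩ := exists_norm_Gamma_mul_cpow_le hσ hθ0 hθ
  obtain ⟨C₂, hC₂, h₂⟩ := exists_norm_Gamma_mul_cpow_le (σ := υ.re - σ / 2) (by linarith) hθ0 hθ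
  refine ⟨C₁ * ‖w‖ ^ (-σ) * (C₂ * y ^ (-(υ.re - σ / 2)) *
    Real.exp ((Real.pi / 2 - θ) * |υ.im|)), (Real.pi / 2 - φ) / 4, by linarith, ?_⟩
  intro p hyp hp s hs
  have hp0 : p ≠ 0 := norm_pos_iff.1 (hy.trans_le hyp)
  have harg : |p.arg| ≤ Real.pi / 2 := Complex.abs_arg_le_pi_div_two_iff.2 hp
  have him : |(υ - s / 2).im| ≤ |υ.im| + |s.im| / 2 := by
    have : (υ - s / 2).im = υ.im - s.im / 2 := by simp
    rw [this]
    refine (abs_sub _ _).trans ?_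
    rw [abs_div, abs_two]
  have e₂ : ‖Complex.Gamma (υ - s / 2) * p ^ (-(υ - s / 2))‖ ≤
      C₂ * y ^ (-(υ.re - σ / 2)) * Real.exp ((Real.pi / 2 - θ) * (|υ.im| + |s.im| / 2)) := by
    refine (h₂ p hp0 _ (by simp [hs])).trans ?_
    have hpow : ‖p‖ ^ (-(υ.re - σ / 2)) ≤ y ^ (-(υ.re - σ / 2)) :=
      Real.rpow_le_rpow_of_nonpos hy hyp (by linarith)
    have : (|p.arg| - θ) * |(υ - s / 2).im| ≤ (Real.pi / 2 - θ) * (|υ.im| + |s.im| / 2) :=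
      mul_le_mul (by linarith) him (abs_nonneg _) (by linarith)
    gcongr
  rw [norm_mul]
  calc _ ≤ C₁ * ‖w‖ ^ (-σ) * Real.exp ((φ - θ) * |s.im|) *
        (C₂ * y ^ (-(υ.re - σ / 2)) * Real.exp ((Real.pi / 2 - θ) * (|υ.im| + |s.im| / 2))) :=
        mul_le_mul (h₁ w hw0 s hs) e₂ (norm_nonneg _) (by positivity)
    _ = C₁ * ‖w‖ ^ (-σ) * (C₂ * y ^ (-(υ.re - σ / 2))) *
        Real.exp ((Real.pi / 2 - θ) * |υ.im| + -((Real.pi / 2 - φ) / 4) * |s.im|) := by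
        rw [show (Real.pi / 2 - θ) * |υ.im| + -((Real.pi / 2 - φ) / 4) * |s.im| =
          (φ - θ) * |s.im| + (Real.pi / 2 - θ) * (|υ.im| + |s.im| / 2) by rw [hθdef]; ring,
          Real.exp_add]
        ring
    _ ≤ _ := by
        rw [Real.exp_add]
        refine le_of_eq ?_
        ring

theorem continuous_Gamma_line {f : ℝ → ℂ} (hf : Continuous f) (h : ∀ t, 0 < (f t).re) :
    Continuous fun t => Complex.Gamma (f t) := by
  refine continuous_iff_continuousAt.2 fun t => ContinuousAt.comp ?_ hf.continuousAt
  refine (Complex.differentiableAt_Gamma _ fun m hm => ?_).continuousAt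
  have := h t
  rw [hm] at this
  simp at this
  linarith [(Nat.cast_nonneg m : (0 : ℝ) ≤ m)]

theorem continuous_barnes {υ w p : ℂ} {σ : ℝ} (hw : w ≠ 0) (hp : p ≠ 0) (hσ : 0 < σ)
    (hσ' : σ < 2 * υ.re) :
    Continuous fun t : ℝ => Complex.Gamma (σ + t * Complex.I) * w ^ (-(σ + t * Complex.I)) *
      (Complex.Gamma (υ - (σ + t * Complex.I) / 2) * p ^ (-(υ - (σ + t * Complex.I) / 2))) := by
  refine ((continuous_Gamma_line (by fun_prop) fun t => ?_).mul
    (Continuous.const_cpow (by fun_prop) (Or.inl hw))).mul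
    ((continuous_Gamma_line (by fun_prop) fun t => ?_).mul
    (Continuous.const_cpow (by fun_prop) (Or.inl hp)))
  · simpa using hσ
  · simp; linarith

theorem integrable_barnes {υ w p : ℂ} {σ : ℝ} (hw : 0 < w.re) (hp : p ≠ 0) (hp' : 0 ≤ p.re)
    (hσ : 0 < σ) (hσ' : σ < 2 * υ.re) :
    Integrable fun t : ℝ => Complex.Gamma (σ + t * Complex.I) * w ^ (-(σ + t * Complex.I)) *
      (Complex.Gamma (υ - (σ + t * Complex.I) / 2) * p ^ (-(υ - (σ + t * Complex.I) / 2))) := by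
  obtain ⟨C, δ, hδ, h⟩ := exists_norm_barnes_le hw hσ hσ' (norm_pos_iff.2 hp)
  refine ((integrable_exp_neg_mul_abs hδ).const_mul C).mono'
    (continuous_barnes (by rintro rfl; simp at hw) hp hσ hσ').aestronglyMeasurable ?_
  filter_upwards with t
  simpa using h p le_rfl hp' (σ + t * Complex.I) (by simp)

theorem integrable_Gamma_mul_cpow {w : ℂ} {σ : ℝ} (hw : 0 < w.re) (hσ : 0 < σ) :
    Integrable fun t : ℝ => Complex.Gamma (σ + t * Complex.I) * w ^ (-(σ + t * Complex.I)) := by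
  have hw0 : w ≠ 0 := by rintro rfl; simp at hw
  have hφ : |w.arg| < Real.pi / 2 := Complex.abs_arg_lt_pi_div_two_iff.2 (Or.inl hw)
  have hφ0 := abs_nonneg w.arg
  obtain ⟨C, -, h⟩ := exists_norm_Gamma_mul_cpow_le (θ := (|w.arg| + Real.pi / 2) / 2) hσ
    (by positivity) (by linarith)
  refine ((integrable_exp_neg_mul_abs (δ := (Real.pi / 2 - |w.arg|) / 2) (by linarith)).const_mul
    (C * ‖w‖ ^ (-σ))).mono' (Continuous.aestronglyMeasurable ?_) ?_
  · refine (continuous_Gamma_line (by fun_prop) fun t => ?_).mul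
      (Continuous.const_cpow (by fun_prop) (Or.inl hw0))
    simpa using hσ
  · filter_upwards with t
    refine (h w hw0 (σ + t * Complex.I) (by simp)).trans_eq ?_
    simp
    left
    ring

/-! ### Laplace, Fourier and cosine transforms as Mellin-Barnes integrals -/

/-- The Cahen-Mellin integral, in the right half-plane. -/
theorem exp_neg_mul_eq_integral {w : ℂ} {σ u : ℝ} (hw : 0 < w.re) (hσ : 0 < σ) (hu : 0 < u) :
    Complex.exp (-(w * u)) = 1 / (2 * Real.pi) * ∫ t : ℝ, (u : ℂ) ^ (-(σ + t * Complex.I)) *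
      (Complex.Gamma (σ + t * Complex.I) * w ^ (-(σ + t * Complex.I))) := by
  have hm : ∀ t : ℝ, mellin (fun u : ℝ => Complex.exp (-(w * u))) (σ + t * Complex.I) =
      Complex.Gamma (σ + t * Complex.I) * w ^ (-(σ + t * Complex.I)) := fun t => by
    simpa [mellin] using integral_cpow_mul_exp_neg_mul (a := σ + t * Complex.I) (by simpa) hw
  have h := mellinInv_mellin_eq σ (fun u : ℝ => Complex.exp (-(w * u))) hu
    (by simpa [MellinConvergent] using
      integrableOn_cpow_mul_exp_neg_mul (a := σ) (r := w) (by simpa) hw)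
    (by simpa only [Complex.VerticalIntegrable, hm] using integrable_Gamma_mul_cpow hw hσ)
    (by fun_prop)
  rw [← h, mellinInv]
  simp only [hm, smul_eq_mul, Complex.real_smul]
  simp

theorem ofReal_sqrt_cpow_neg {x : ℝ} (hx : 0 ≤ x) (s : ℂ) :
    (Real.sqrt x : ℂ) ^ (-s) = (x : ℂ) ^ (-s / 2) := by
  rw [Real.sqrt_eq_rpow, ← Complex.cpow_mul_ofReal_nonneg hx]
  congr 1
  push_cast
  ring

/-- Insert the Cahen-Mellin integral at `u = √x` and exchange the integrals: `√x ^ (-s)` lowers the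
exponent `υ` to `υ - s/2`, so the inner integral is again the Laplace transform of a power. The
condition `σ < 2 Re υ` makes it converge at `0`. -/
theorem laplace_sqrt_eq_barnes {υ w p : ℂ} {σ : ℝ} (hw : 0 < w.re) (hp : 0 < p.re)
    (hσ : 0 < σ) (hσ' : σ < 2 * υ.re) :
    ∫ x : ℝ in Ioi 0, (x : ℂ) ^ (υ - 1) * Complex.exp (-w * (Real.sqrt x : ℂ)) *
        Complex.exp (-(p * x)) =
      1 / (2 * Real.pi) * ∫ t : ℝ, Complex.Gamma (σ + t * Complex.I) *
        w ^ (-(σ + t * Complex.I)) * (Complex.Gamma (υ - (σ + t * Complex.I) / 2) *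
          p ^ (-(υ - (σ + t * Complex.I) / 2))) := by
  set h : ℝ → ℂ := fun t => Complex.Gamma (σ + t * Complex.I) * w ^ (-(σ + t * Complex.I)) with hh
  have hint : Integrable h := integrable_Gamma_mul_cpow hw hσ
  set F : ℝ → ℝ → ℂ := fun x t => (x : ℂ) ^ (υ - 1) * Complex.exp (-(p * x)) *
    ((Real.sqrt x : ℂ) ^ (-(σ + t * Complex.I)) * h t) with hF
  have hFeq : ∀ x ∈ Ioi (0 : ℝ), ∀ t, F x t =
      h t * ((x : ℂ) ^ (υ - (σ + t * Complex.I) / 2 - 1) * Complex.exp (-(p * x))) := by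
    intro x hx t
    have hx' : (0 : ℝ) < x := hx
    have hx0 : (x : ℂ) ≠ 0 := by exact_mod_cast hx'.ne'
    rw [hF]
    simp only
    rw [ofReal_sqrt_cpow_neg hx'.le, show υ - (σ + t * Complex.I) / 2 - 1 =
      (υ - 1) + -(σ + t * Complex.I) / 2 by ring, Complex.cpow_add _ _ hx0]
    ring
  have hmeas : AEStronglyMeasurable (Function.uncurry F) ((volume.restrict (Ioi 0)).prod volume) := by
    have h2 : AEStronglyMeasurable (fun z : ℝ × ℝ => h z.2) ((volume.restrict (Ioi 0)).prod volume) :=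
      hint.aestronglyMeasurable.comp_snd
    have h1 : Measurable (fun z : ℝ × ℝ => (z.1 : ℂ) ^ (υ - 1) * Complex.exp (-(p * z.1)) *
      ((Real.sqrt z.1 : ℂ) ^ (-(σ + z.2 * Complex.I)))) := by fun_prop
    refine (h1.aestronglyMeasurable.mul h2).congr (Eventually.of_forall fun z => ?_)
    simp [hF, Function.uncurry, mul_assoc]
  have hFint : Integrable (Function.uncurry F) ((volume.restrict (Ioi 0)).prod volume) := by
    -- The norm of `F x t` is a product of a function of `x` and a function of `t`, since `Re s = σ`
    -- is fixed.
    have hb := (integrableOn_rpow_mul_exp_neg_mul (a := υ.re - σ / 2) (r := p.re)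
      (by linarith) hp).integrable.mul_prod hint.norm
    refine hb.mono' hmeas ?_
    have : ∀ᵐ z ∂((volume.restrict (Ioi (0 : ℝ))).prod (volume : Measure ℝ)), z.1 ∈ Ioi (0 : ℝ) :=
      Measure.quasiMeasurePreserving_fst.ae (ae_restrict_mem measurableSet_Ioi)
    filter_upwards [this] with z hz
    rw [Function.uncurry, hFeq _ hz, norm_mul, norm_cpow_sub_one_mul_exp hz, mul_comm]
    simp
  calc _ = ∫ x : ℝ in Ioi 0, 1 / (2 * Real.pi) * ∫ t : ℝ, F x t := by
        refine setIntegral_congr_fun measurableSet_Ioi fun x hx => ?_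
        simp only [hF]
        rw [integral_const_mul, neg_mul, exp_neg_mul_eq_integral hw hσ (Real.sqrt_pos.2 hx)]
        ring
    _ = 1 / (2 * Real.pi) * ∫ t : ℝ, ∫ x : ℝ in Ioi 0, F x t := by
        rw [integral_const_mul, integral_integral_swap hFint]
    _ = _ := by
        congr 2
        funext t
        rw [setIntegral_congr_fun measurableSet_Ioi fun x hx => hFeq x hx t, integral_const_mul,
          integral_cpow_mul_exp_neg_mul _ hp]
        simp
        linarith

theorem integrableOn_rpow_mul_exp_neg_sqrt {a r : ℝ} (ha : 0 < a) (hr : 0 < r) :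
    IntegrableOn (fun x : ℝ => x ^ (a - 1) * Real.exp (-r * Real.sqrt x)) (Ioi 0) := by
  simpa [Real.sqrt_eq_rpow] using integrableOn_rpow_mul_exp_neg_mul_rpow (p := 1 / 2) (s := a - 1)
    (b := r) (by linarith) (by norm_num) hr

theorem norm_cpow_mul_exp_neg_sqrt {a r : ℂ} {x : ℝ} (hx : 0 < x) :
    ‖(x : ℂ) ^ (a - 1) * Complex.exp (-r * (Real.sqrt x : ℂ))‖ =
      x ^ (a.re - 1) * Real.exp (-r.re * Real.sqrt x) := by
  rw [norm_mul, Complex.norm_cpow_eq_rpow_re_of_pos hx, Complex.norm_exp]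
  simp

theorem integrableOn_cpow_mul_exp_neg_sqrt_mul {υ w : ℂ} {g : ℝ → ℂ} (hυ : 0 < υ.re)
    (hw : 0 < w.re) (hg : ContinuousOn g (Ioi 0)) (hb : ∀ x, 0 < x → ‖g x‖ ≤ 1) :
    IntegrableOn (fun x : ℝ => (x : ℂ) ^ (υ - 1) * Complex.exp (-w * (Real.sqrt x : ℂ)) * g x)
      (Ioi 0) := by
  refine (integrableOn_rpow_mul_exp_neg_sqrt hυ hw).mono' ?_ ?_
  · exact (((continuousOn_cpow_const_Ioi _).mul
      (by fun_prop)).mul hg).aestronglyMeasurable measurableSet_Ioi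
  · filter_upwards [ae_restrict_mem measurableSet_Ioi] with x hx
    rw [norm_mul, norm_cpow_mul_exp_neg_sqrt hx]
    refine mul_le_of_le_one_right ?_ (hb x hx)
    have : (0 : ℝ) < x := hx
    positivity

/-- Boundary value of the Laplace formula at `p = ε + i y` as `ε → 0+`. On the left `exp (-w √x)`
dominates; on the right `exists_norm_barnes_le` applies uniformly because `‖p‖ ≥ |y|`. Both signs of
`y` are needed for the cosine. -/
theorem fourier_sqrt_eq_barnes {υ w : ℂ} {σ y : ℝ} (hw : 0 < w.re) (hy : y ≠ 0)
    (hσ : 0 < σ) (hσ' : σ < 2 * υ.re) :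
    ∫ x : ℝ in Ioi 0, (x : ℂ) ^ (υ - 1) * Complex.exp (-w * (Real.sqrt x : ℂ)) *
        Complex.exp (-((y * Complex.I) * x)) =
      1 / (2 * Real.pi) * ∫ t : ℝ, Complex.Gamma (σ + t * Complex.I) *
        w ^ (-(σ + t * Complex.I)) * (Complex.Gamma (υ - (σ + t * Complex.I) / 2) *
          (y * Complex.I) ^ (-(υ - (σ + t * Complex.I) / 2))) := by
  have hυ : 0 < υ.re := by linarith
  have hw0 : w ≠ 0 := by rintro rfl; simp at hw
  have hp0 : ∀ ε : ℝ, (ε + y * Complex.I : ℂ) ≠ 0 := fun ε h => hy (by simpa using congrArg Complex.im h)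
  have hlim : Tendsto (fun ε : ℝ => (ε + y * Complex.I : ℂ)) (𝓝[>] 0) (𝓝 (y * Complex.I)) := by
    have : Continuous fun ε : ℝ => (ε + y * Complex.I : ℂ) := by fun_prop
    simpa using (this.tendsto 0).mono_left nhdsWithin_le_nhds
  have hL : Tendsto (fun ε : ℝ => ∫ x : ℝ in Ioi 0, (x : ℂ) ^ (υ - 1) *
      Complex.exp (-w * (Real.sqrt x : ℂ)) * Complex.exp (-((ε + y * Complex.I) * x))) (𝓝[>] 0)
      (𝓝 (∫ x : ℝ in Ioi 0, (x : ℂ) ^ (υ - 1) * Complex.exp (-w * (Real.sqrt x : ℂ)) *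
        Complex.exp (-((y * Complex.I) * x)))) := by
    refine tendsto_integral_filter_of_dominated_convergence
      (fun x => x ^ (υ.re - 1) * Real.exp (-w.re * Real.sqrt x)) ?_ ?_
      (integrableOn_rpow_mul_exp_neg_sqrt hυ hw) ?_
    · exact Eventually.of_forall fun ε => (((continuousOn_cpow_const_Ioi _).mul
        (by fun_prop)).mul (by fun_prop)).aestronglyMeasurable measurableSet_Ioi
    · filter_upwards [self_mem_nhdsWithin] with ε hε
      filter_upwards [ae_restrict_mem measurableSet_Ioi] with x hx
      have hx' : (0 : ℝ) < x := hx
      have hε' : (0 : ℝ) < ε := hε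
      rw [norm_mul, norm_cpow_mul_exp_neg_sqrt hx]
      refine mul_le_of_le_one_right (by positivity) ?_
      rw [Complex.norm_exp, Real.exp_le_one_iff]
      simp
      positivity
    · filter_upwards with x
      exact ((Complex.continuous_exp.tendsto _).comp (hlim.mul_const _).neg).const_mul _
  have hR : Tendsto (fun ε : ℝ => ∫ t : ℝ, Complex.Gamma (σ + t * Complex.I) *
        w ^ (-(σ + t * Complex.I)) * (Complex.Gamma (υ - (σ + t * Complex.I) / 2) *
          (ε + y * Complex.I) ^ (-(υ - (σ + t * Complex.I) / 2)))) (𝓝[>] 0)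
      (𝓝 (∫ t : ℝ, Complex.Gamma (σ + t * Complex.I) *
        w ^ (-(σ + t * Complex.I)) * (Complex.Gamma (υ - (σ + t * Complex.I) / 2) *
          (y * Complex.I) ^ (-(υ - (σ + t * Complex.I) / 2))))) := by
    obtain ⟨C, δ, hδ, h⟩ := exists_norm_barnes_le hw hσ hσ' (abs_pos.2 hy)
    refine tendsto_integral_filter_of_dominated_convergence
      (fun t => C * Real.exp (-δ * |t|)) ?_ ?_ ((integrable_exp_neg_mul_abs hδ).const_mul C) ?_
    · exact Eventually.of_forall fun ε =>
        (continuous_barnes hw0 (hp0 ε) hσ hσ').aestronglyMeasurable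
    · filter_upwards [self_mem_nhdsWithin] with ε hε
      filter_upwards with t
      have hε' : (0 : ℝ) < ε := hε
      have h1 : |y| ≤ ‖(ε + y * Complex.I : ℂ)‖ := by
        simpa using Complex.abs_im_le_norm (ε + y * Complex.I : ℂ)
      simpa using h _ h1 (by simpa using hε'.le) (σ + t * Complex.I) (by simp)
    · filter_upwards with t
      refine Tendsto.const_mul _ (Tendsto.const_mul _ ?_)
      -- The limit `i y` lies off the branch cut because `y ≠ 0`.
      exact hlim.cpow tendsto_const_nhds (Or.inr (by simpa using hy))
  refine tendsto_nhds_unique (hL.congr' ?_) (hR.const_mul _)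
  filter_upwards [self_mem_nhdsWithin] with ε hε
  exact laplace_sqrt_eq_barnes hw (by simpa using hε) hσ hσ'

/-- The logarithms of `± i y` are `log y ± i π/2`, so the two phases are `exp (∓ i π a/2)` and add
up to a cosine. -/
theorem cpow_neg_mul_I_add {y : ℝ} (hy : 0 < y) (a : ℂ) :
    (y * Complex.I) ^ (-a) + ((-y : ℝ) * Complex.I) ^ (-a) =
      2 * ((y : ℂ) ^ (-a) * Complex.cos (Real.pi * a / 2)) := by
  have hy0 : (y : ℂ) ≠ 0 := by exact_mod_cast hy.ne'
  have h1 : (y * Complex.I) ≠ 0 := mul_ne_zero hy0 Complex.I_ne_zero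
  have h2 : (y * -Complex.I) ≠ 0 := mul_ne_zero hy0 (neg_ne_zero.2 Complex.I_ne_zero)
  rw [Complex.ofReal_neg, neg_mul, ← mul_neg, Complex.cpow_def_of_ne_zero h1,
    Complex.cpow_def_of_ne_zero h2, Complex.cpow_def_of_ne_zero hy0,
    Complex.log_ofReal_mul hy Complex.I_ne_zero,
    Complex.log_ofReal_mul hy (neg_ne_zero.2 Complex.I_ne_zero), Complex.log_I, Complex.log_neg_I,
    Complex.ofReal_log hy.le, Complex.cos]
  rw [add_mul, add_mul, Complex.exp_add, Complex.exp_add]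
  rw [show (Real.pi : ℂ) / 2 * Complex.I * -a = -(Real.pi * a / 2) * Complex.I by ring,
    show -((Real.pi : ℂ) / 2) * Complex.I * -a = (Real.pi * a / 2) * Complex.I by ring]
  ring

theorem integrable_cos_barnes {υ w : ℂ} {σ y : ℝ} (hw : 0 < w.re) (hy : 0 < y)
    (hσ : 0 < σ) (hσ' : σ < 2 * υ.re) :
    Integrable fun t : ℝ => Complex.Gamma (σ + t * Complex.I) * w ^ (-(σ + t * Complex.I)) *
      (Complex.Gamma (υ - (σ + t * Complex.I) / 2) * ((y : ℂ) ^ (-(υ - (σ + t * Complex.I) / 2)) *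
        Complex.cos (Real.pi * (υ - (σ + t * Complex.I) / 2) / 2))) := by
  have hne : ∀ z : ℝ, z ≠ 0 → (z * Complex.I : ℂ) ≠ 0 := fun z hz =>
    mul_ne_zero (by exact_mod_cast hz) Complex.I_ne_zero
  have h1 := integrable_barnes (p := y * Complex.I) hw (hne y hy.ne') (by simp) hσ hσ'
  have h2 := integrable_barnes (p := (-y : ℝ) * Complex.I) hw (hne (-y) (by linarith)) (by simp)
    hσ hσ'
  refine ((h1.add h2).const_mul (1 / 2)).congr (Eventually.of_forall fun t => ?_)
  simp only [Pi.add_apply]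
  rw [← mul_add, ← mul_add, cpow_neg_mul_I_add hy]
  ring

/-- The cosine transform of `x ^ (υ - 1) * exp (-w √x)` as a Mellin-Barnes integral. -/
theorem integral_cos_sqrt_eq_barnes {υ w : ℂ} {σ y : ℝ} (hw : 0 < w.re) (hy : 0 < y)
    (hσ : 0 < σ) (hσ' : σ < 2 * υ.re) :
    ∫ x : ℝ in Ioi 0, (x : ℂ) ^ (υ - 1) * Complex.exp (-w * (Real.sqrt x : ℂ)) *
        (Real.cos (x * y) : ℂ) =
      1 / (2 * Real.pi) * ∫ t : ℝ, Complex.Gamma (σ + t * Complex.I) *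
        w ^ (-(σ + t * Complex.I)) * (Complex.Gamma (υ - (σ + t * Complex.I) / 2) *
          ((y : ℂ) ^ (-(υ - (σ + t * Complex.I) / 2)) *
            Complex.cos (Real.pi * (υ - (σ + t * Complex.I) / 2) / 2))) := by
  have hυ : 0 < υ.re := by linarith
  have hne : ∀ z : ℝ, z ≠ 0 → (z * Complex.I : ℂ) ≠ 0 := fun z hz =>
    mul_ne_zero (by exact_mod_cast hz) Complex.I_ne_zero
  have h1 := integrable_barnes (p := y * Complex.I) hw (hne y hy.ne') (by simp) hσ hσ'
  have h2 := integrable_barnes (p := (-y : ℝ) * Complex.I) hw (hne (-y) (by linarith)) (by simp)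
    hσ hσ'
  have hi : ∀ z : ℝ, IntegrableOn (fun x : ℝ => (x : ℂ) ^ (υ - 1) *
      Complex.exp (-w * (Real.sqrt x : ℂ)) * Complex.exp (-((z * Complex.I) * x))) (Ioi 0) :=
    fun z => integrableOn_cpow_mul_exp_neg_sqrt_mul hυ hw (by fun_prop) fun x _ => by
      rw [Complex.norm_exp]; simp
  have e1 := fourier_sqrt_eq_barnes hw hy.ne' hσ hσ'
  have e2 := fourier_sqrt_eq_barnes (y := -y) hw (by linarith) hσ hσ'
  calc _ = ∫ x : ℝ in Ioi 0, (1 / 2 : ℂ) * ((x : ℂ) ^ (υ - 1) *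
          Complex.exp (-w * (Real.sqrt x : ℂ)) * Complex.exp (-((y * Complex.I) * x)) +
          (x : ℂ) ^ (υ - 1) * Complex.exp (-w * (Real.sqrt x : ℂ)) *
          Complex.exp (-(((-y : ℝ) * Complex.I) * x))) := by
        refine setIntegral_congr_fun measurableSet_Ioi fun x _ => ?_
        rw [Complex.ofReal_cos, Complex.cos]
        push_cast
        rw [show -((x : ℂ) * y) * Complex.I = -(y * Complex.I * x) by ring,
          show ((x : ℂ) * y) * Complex.I = -(-y * Complex.I * x) by ring]
        ring
    _ = _ := by
        rw [integral_const_mul, integral_add (hi y) (hi (-y)), e1, e2, ← mul_add,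
          ← integral_add h1 h2, ← mul_assoc, mul_comm (1 / 2 : ℂ), mul_assoc,
          ← integral_const_mul]
        congr 2
        funext t
        rw [← mul_add, ← mul_add, cpow_neg_mul_I_add hy]
        ring

/-! ### Vertical line integrals and Meijer's G-function -/

/-- `1 / (2πi) ∫ g(ζ) dζ` converges absolutely to `V` along each vertical line `Re ζ = σ`, `σ ∈ S`. -/
def HasLineIntegral (S : Set ℝ) (g : ℂ → ℂ) (V : ℂ) : Prop :=
  ∀ σ ∈ S, Integrable (fun t : ℝ => g (σ + t * Complex.I)) ∧
    1 / (2 * (Real.pi : ℂ)) * ∫ t : ℝ, g (σ + t * Complex.I) = V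

/-- Substitution `s = m ζ + c`: the real part of `c` moves the line, its imaginary part only
translates the parameter `t`, and `m` contributes the Jacobian `1/m`. -/
theorem HasLineIntegral.comp_affine {S S' : Set ℝ} {f g : ℂ → ℂ} {V : ℂ}
    (h : HasLineIntegral S g V) {m : ℝ} (hm : 0 < m) (c K : ℂ)
    (hS : ∀ σ ∈ S', m * σ + c.re ∈ S)
    (hf : ∀ σ ∈ S', ∀ ζ : ℂ, ζ.re = σ → f ζ = K * g (m * ζ + c)) :
    HasLineIntegral S' f (K * (V / m)) := by
  intro σ hσ
  obtain ⟨h1, h2⟩ := h _ (hS σ hσ)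
  set G : ℝ → ℂ := fun t => g ((m * σ + c.re : ℝ) + t * Complex.I) with hG
  have e : (fun t : ℝ => f (σ + t * Complex.I)) = fun t => K * G (m * t + c.im) := by
    funext t
    rw [hf σ hσ _ (by simp), hG]
    simp only
    congr 2
    apply Complex.ext <;> simp
  have i1 : Integrable fun t => G (m * t + c.im) :=
    (h1.comp_add_right c.im).comp_mul_left' hm.ne'
  refine ⟨e ▸ i1.const_mul K, ?_⟩
  rw [e, integral_const_mul, Measure.integral_comp_mul_left (fun t => G (t + c.im)) m,
    integral_add_right_eq_self G, ← h2, abs_of_pos (inv_pos.2 hm), Complex.real_smul]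
  push_cast
  ring

/-- Because every separating line gives the same `V`, the line chosen in the definition of `meijerG`
is immaterial. -/
theorem HasLineIntegral.meijer {a₁ a₂ b₁ b₂ : List ℂ} {ℓ V : ℂ} {S : Set ℝ}
    (h : HasLineIntegral S (meijerIntegrand a₁ a₂ b₁ b₂ ℓ) V)
    (hS : ∀ σ, SeparatesPoles a₁ b₁ σ ↔ σ ∈ S) (hne : S.Nonempty) :
    MeijerGConverges a₁ a₂ b₁ b₂ ℓ ∧ meijerG a₁ a₂ b₁ b₂ ℓ = V := by
  have hline : ∀ σ ∈ S, meijerLineIntegral a₁ a₂ b₁ b₂ ℓ σ = V := fun σ hσ => by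
    rw [← (h σ hσ).2, meijerLineIntegral, integral_mul_const]
    have := Complex.I_ne_zero
    field_simp
  have hex : ∃ σ : ℝ, SeparatesPoles a₁ b₁ σ := hne.imp fun σ hσ => (hS σ).2 hσ
  have hG : meijerG a₁ a₂ b₁ b₂ ℓ = V := by
    rw [meijerG, dif_pos hex]
    exact hline _ ((hS _).1 hex.choose_spec)
  exact ⟨⟨hex, fun σ hσ => ⟨(h σ ((hS σ).1 hσ)).1, by rw [hG, hline σ ((hS σ).1 hσ)]⟩⟩, hG⟩

/-- Every Gamma factor depends only on the difference of `ζ` and a parameter. This is the source of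
the second, third and fourth G-series. -/
theorem meijerIntegrand_map_add (a₁ a₂ b₁ b₂ : List ℂ) (δ ℓ ζ : ℂ) :
    meijerIntegrand (a₁.map (· + δ)) (a₂.map (· + δ)) (b₁.map (· + δ)) (b₂.map (· + δ)) ℓ ζ =
      Complex.exp (δ * ℓ) * meijerIntegrand a₁ a₂ b₁ b₂ ℓ (ζ - δ) := by
  have h1 : ∀ α : ℂ, 1 - (α + δ) + ζ = 1 - α + (ζ - δ) := fun α => by ring
  have h2 : ∀ α : ℂ, α + δ - ζ = α - (ζ - δ) := fun α => by ring
  simp only [meijerIntegrand, List.map_map, Function.comp_def, h1, h2]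
  rw [show ζ * ℓ = δ * ℓ + (ζ - δ) * ℓ by ring, Complex.exp_add]
  ring

/-! ### Gamma identities and comparison of the integrands -/

/-- Multiplication formula of order four, from duplication at `z`, at `z + 1/4`, and then at `2z`.
-/
theorem Gamma_mul_quarters (z : ℂ) :
    Complex.Gamma z * Complex.Gamma (z + 1 / 4) * Complex.Gamma (z + 1 / 2) *
        Complex.Gamma (z + 3 / 4) =
      Complex.Gamma (4 * z) * (2 : ℂ) ^ (5 / 2 - 8 * z) * (Real.sqrt Real.pi : ℂ) ^ 3 := by
  have h1 := Complex.Gamma_mul_Gamma_add_half z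
  have h2 := Complex.Gamma_mul_Gamma_add_half (z + 1 / 4)
  have h3 := Complex.Gamma_mul_Gamma_add_half (2 * z)
  rw [show z + 1 / 4 + 1 / 2 = z + 3 / 4 by ring, show 2 * (z + 1 / 4) = 2 * z + 1 / 2 by ring] at h2
  rw [show (2 : ℂ) * (2 * z) = 4 * z by ring] at h3
  calc _ = (Complex.Gamma z * Complex.Gamma (z + 1 / 2)) *
        (Complex.Gamma (z + 1 / 4) * Complex.Gamma (z + 3 / 4)) := by ring
    _ = (Complex.Gamma (2 * z) * Complex.Gamma (2 * z + 1 / 2)) * ((2 : ℂ) ^ (1 - 2 * z) *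
        (2 : ℂ) ^ (1 - (2 * z + 1 / 2))) * (Real.sqrt Real.pi : ℂ) ^ 2 := by rw [h1, h2]; ring
    _ = Complex.Gamma (4 * z) * ((2 : ℂ) ^ (1 - 2 * z) * (2 : ℂ) ^ (1 - (2 * z + 1 / 2)) *
        (2 : ℂ) ^ (1 - 4 * z)) * (Real.sqrt Real.pi : ℂ) ^ 3 := by rw [h3]; ring
    _ = _ := by
        rw [← Complex.cpow_add _ _ two_ne_zero, ← Complex.cpow_add _ _ two_ne_zero]
        congr 3
        ring

theorem sqrt_pi_sq : (Real.sqrt Real.pi : ℂ) ^ 2 = Real.pi := by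
  rw [← Complex.ofReal_pow, Real.sq_sqrt Real.pi_pos.le]

theorem ofReal_log_two : Complex.log 2 = (Real.log 2 : ℂ) := by
  simp

/-- Duplication at `-ζ` combined with reflection at `1/2 - ζ`. The bound on `Re ζ` ensures `Γ(1/2 -
ζ) ≠ 0`, so that it can be cancelled. -/
theorem Gamma_neg_div_Gamma_half_add {ζ : ℂ} (hζ : ζ.re < 1 / 2) :
    Complex.Gamma (-ζ) / Complex.Gamma (1 / 2 + ζ) * (Real.sqrt Real.pi : ℂ) =
      Complex.Gamma (-2 * ζ) * Complex.cos (Real.pi * ζ) * (2 : ℂ) ^ (1 + 2 * ζ) := by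
  have h1 := Complex.Gamma_mul_Gamma_add_half (-ζ)
  have h2 := congrArg Inv.inv (Complex.Gamma_mul_Gamma_one_sub (1 / 2 - ζ))
  have hne : Complex.Gamma (-ζ + 1 / 2) ≠ 0 := Complex.Gamma_ne_zero_of_re_pos (by
    simp
    linarith)
  have hpi : (Real.pi : ℂ) ≠ 0 := by exact_mod_cast Real.pi_pos.ne'
  have hsin : Complex.sin (Real.pi * (1 / 2 - ζ)) = Complex.cos (Real.pi * ζ) := by
    rw [mul_sub, mul_one_div, Complex.sin_pi_div_two_sub]
  rw [hsin, inv_div, mul_inv, show 1 - (1 / 2 - ζ) = 1 / 2 + ζ by ring,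
    show 1 / 2 - ζ = -ζ + 1 / 2 by ring] at h2
  have h3 : (Complex.Gamma (1 / 2 + ζ))⁻¹ =
      Complex.Gamma (-ζ + 1 / 2) * (Complex.cos (Real.pi * ζ) / Real.pi) := by
    rw [← h2, mul_inv_cancel_left₀ hne]
  rw [show 2 * -ζ = -2 * ζ by ring, show 1 - -2 * ζ = 1 + 2 * ζ by ring] at h1
  rw [div_eq_mul_inv, h3, ← mul_assoc, h1]
  field_simp
  rw [sqrt_pi_sq]


theorem exp_mul_log4 {y : ℝ} (hy : 0 < y) {w : ℂ} (hw : w ≠ 0) (ζ : ℂ) :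
    Complex.exp (ζ * log4 y w) = (2 : ℂ) ^ (6 * ζ) * (y : ℂ) ^ (2 * ζ) * w ^ (-(4 * ζ)) := by
  have hy0 : (y : ℂ) ≠ 0 := by exact_mod_cast hy.ne'
  have hl : Real.log (64 * y ^ 2) = 6 * Real.log 2 + 2 * Real.log y := by
    rw [Real.log_mul (by norm_num) (by positivity), Real.log_pow, show (64 : ℝ) = 2 ^ 6 by norm_num,
      Real.log_pow]
    norm_num
  rw [Complex.cpow_def_of_ne_zero hw, Complex.cpow_def_of_ne_zero two_ne_zero,
    Complex.cpow_def_of_ne_zero hy0, ← Complex.exp_add, ← Complex.exp_add, log4, hl]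
  congr 1
  rw [ofReal_log_two, ← Complex.ofReal_log hy.le]
  push_cast
  ring

theorem exp_mul_log8 {y : ℝ} (hy : 0 < y) (w ζ : ℂ) :
    Complex.exp (ζ * log8 y w) = (2 : ℂ) ^ (4 * ζ) * Complex.exp (2 * ζ * log4 y w) := by
  have h4 : Real.log 4 = 2 * Real.log 2 := by
    rw [show (4 : ℝ) = 2 ^ 2 by norm_num, Real.log_pow]
    norm_num
  have hl : Real.log (4 ^ 8 * y ^ 4) = 4 * Real.log 2 + 2 * Real.log (64 * y ^ 2) := by
    rw [Real.log_mul (by norm_num) (by positivity), Real.log_mul (by norm_num) (by positivity),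
      Real.log_pow, Real.log_pow, show (64 : ℝ) = 2 ^ 6 by norm_num, Real.log_pow,
      h4, Real.log_pow]
    push_cast
    ring
  rw [Complex.cpow_def_of_ne_zero two_ne_zero, ← Complex.exp_add, log4, log8, hl]
  congr 1
  rw [ofReal_log_two]
  push_cast
  ring

/-- The Mellin-Barnes integrand of the cosine transform of `x ^ (υ - 1) * exp (-w √x)`. -/
noncomputable def cosBarnes (υ w : ℂ) (y : ℝ) (s : ℂ) : ℂ :=
  Complex.Gamma s * w ^ (-s) *
    (Complex.Gamma (υ - s / 2) * ((y : ℂ) ^ (-(υ - s / 2)) * Complex.cos (Real.pi * (υ - s / 2) / 2)))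

theorem hasLineIntegral_cosBarnes {υ w : ℂ} {y : ℝ} (hw : 0 < w.re) (hy : 0 < y) :
    HasLineIntegral (Ioo 0 (2 * υ.re)) (cosBarnes υ w y) (∫ x : ℝ in Ioi 0,
      (x : ℂ) ^ (υ - 1) * Complex.exp (-w * (Real.sqrt x : ℂ)) * (Real.cos (x * y) : ℂ)) :=
  fun _ hσ => ⟨integrable_cos_barnes hw hy hσ.1 hσ.2, (integral_cos_sqrt_eq_barnes hw hy hσ.1 hσ.2).symm⟩

/-- At `s = 4ζ + 2υ` one has `Γ(υ - s/2) = Γ(-2ζ)` and `Γ(s) = Γ(4(υ/2 + ζ))`: the quotient of lower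
Gamma factors yields the former with the cosine, the four upper ones the latter. -/
theorem meijerIntegrand_upper4_eq {υ w : ℂ} {y : ℝ} (hw : w ≠ 0) (hy : 0 < y) {ζ : ℂ} (hζ : ζ.re < 1 / 2) :
    meijerIntegrand (upper4 4 υ) [] [0] [1 / 2] (log4 y w) ζ =
      Real.pi * (2 : ℂ) ^ (7 / 2 - 4 * υ) * w ^ (2 * υ) * cosBarnes υ w y (4 * ζ + 2 * υ) := by
  have hG := Gamma_mul_quarters (υ / 2 + ζ)
  have hR := Gamma_neg_div_Gamma_half_add hζ
  have hl : meijerIntegrand (upper4 4 υ) [] [0] [1 / 2] (log4 y w) ζ =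
      Complex.Gamma (-ζ) / Complex.Gamma (1 / 2 + ζ) *
        (Complex.Gamma (υ / 2 + ζ) * Complex.Gamma (υ / 2 + ζ + 1 / 4) *
          Complex.Gamma (υ / 2 + ζ + 1 / 2) * Complex.Gamma (υ / 2 + ζ + 3 / 4)) *
        Complex.exp (ζ * log4 y w) := by
    simp only [meijerIntegrand, upper4, List.map_cons, List.map_nil, List.prod_cons, List.prod_nil,
      mul_one]
    rw [show (0 : ℂ) - ζ = -ζ by ring, show 1 - (4 - 2 * υ) / 4 + ζ = υ / 2 + ζ by ring,
      show 1 - (4 - 1 - 2 * υ) / 4 + ζ = υ / 2 + ζ + 1 / 4 by ring,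
      show 1 - (4 - 2 - 2 * υ) / 4 + ζ = υ / 2 + ζ + 1 / 2 by ring,
      show 1 - (4 - 3 - 2 * υ) / 4 + ζ = υ / 2 + ζ + 3 / 4 by ring,
      show (1 : ℂ) - 1 / 2 + ζ = 1 / 2 + ζ by ring]
    ring
  rw [hl, hG, exp_mul_log4 hy hw, cosBarnes]
  rw [show υ - (4 * ζ + 2 * υ) / 2 = -2 * ζ by ring, show -(-2 * ζ) = 2 * ζ by ring,
    show (Real.pi : ℂ) * (-2 * ζ) / 2 = -(Real.pi * ζ) by ring, Complex.cos_neg,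
    show 4 * (υ / 2 + ζ) = 4 * ζ + 2 * υ by ring]
  have hwp : w ^ (-(4 * ζ)) = w ^ (2 * υ) * w ^ (-(4 * ζ + 2 * υ)) := by
    rw [← Complex.cpow_add _ _ hw]; congr 1; ring
  -- The powers of `2` come from the order-four formula, from `64^ζ`, and from the duplication at
  -- `-ζ`; their dependence on `ζ` cancels.
  have h2p : (2 : ℂ) ^ (7 / 2 - 4 * υ) =
      (2 : ℂ) ^ (5 / 2 - 8 * (υ / 2 + ζ)) * (2 : ℂ) ^ (6 * ζ) * (2 : ℂ) ^ (1 + 2 * ζ) := by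
    rw [← Complex.cpow_add _ _ two_ne_zero, ← Complex.cpow_add _ _ two_ne_zero]; congr 1; ring
  rw [hwp, h2p]
  linear_combination (Complex.Gamma (4 * ζ + 2 * υ) * (2 : ℂ) ^ (5 / 2 - 8 * (υ / 2 + ζ)) *
    (Real.sqrt Real.pi : ℂ) ^ 2 * (2 : ℂ) ^ (6 * ζ) * (y : ℂ) ^ (2 * ζ) * (w ^ (2 * υ) *
    w ^ (-(4 * ζ + 2 * υ)))) * hR + (Complex.Gamma (4 * ζ + 2 * υ) *
    (2 : ℂ) ^ (5 / 2 - 8 * (υ / 2 + ζ)) * (2 : ℂ) ^ (6 * ζ) * (y : ℂ) ^ (2 * ζ) * (w ^ (2 * υ) *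
    w ^ (-(4 * ζ + 2 * υ))) * (Complex.Gamma (-2 * ζ) * Complex.cos (Real.pi * ζ) *
    (2 : ℂ) ^ (1 + 2 * ζ))) * sqrt_pi_sq

/-- Six duplications pair the twelve Gamma factors into the six of the smaller integrand at `2ζ`. No
restriction on `ζ` is needed, as the duplication formula also holds at the poles, where
`Complex.Gamma` is `0`. -/
theorem meijerIntegrand_upper8_eq {υ w : ℂ} {y : ℝ} (hy : 0 < y) (ζ : ℂ) :
    meijerIntegrand (upper8 υ) [] [0, 1 / 2] [1 / 4, 3 / 4] (log8 y w) ζ =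
      Real.pi ^ 2 * (2 : ℂ) ^ (3 - 2 * υ) *
        meijerIntegrand (upper4 4 υ) [] [0] [1 / 2] (log4 y w) (2 * ζ) := by
  have h1 := Complex.Gamma_mul_Gamma_add_half (-ζ)
  have h2 := Complex.Gamma_mul_Gamma_add_half (ζ + 1 / 4)
  have h3 := Complex.Gamma_mul_Gamma_add_half (υ / 4 + ζ)
  have h4 := Complex.Gamma_mul_Gamma_add_half (υ / 4 + ζ + 1 / 8)
  have h5 := Complex.Gamma_mul_Gamma_add_half (υ / 4 + ζ + 1 / 4)
  have h6 := Complex.Gamma_mul_Gamma_add_half (υ / 4 + ζ + 3 / 8)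
  have hpi : (Real.sqrt Real.pi : ℂ) ≠ 0 := by
    simpa using (Real.sqrt_pos.2 Real.pi_pos).ne'
  have e4 : meijerIntegrand (upper4 4 υ) [] [0] [1 / 2] (log4 y w) (2 * ζ) =
      Complex.Gamma (2 * -ζ) * (Complex.Gamma (2 * (υ / 4 + ζ)) *
        Complex.Gamma (2 * (υ / 4 + ζ + 1 / 8)) * Complex.Gamma (2 * (υ / 4 + ζ + 1 / 4)) *
        Complex.Gamma (2 * (υ / 4 + ζ + 3 / 8))) / Complex.Gamma (2 * (ζ + 1 / 4)) *
      Complex.exp (2 * ζ * log4 y w) := by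
    simp only [meijerIntegrand, upper4, List.map_cons, List.map_nil, List.prod_cons, List.prod_nil,
      mul_one]
    rw [show (0 : ℂ) - 2 * ζ = 2 * -ζ by ring,
      show 1 - (4 - 2 * υ) / 4 + 2 * ζ = 2 * (υ / 4 + ζ) by ring,
      show 1 - (4 - 1 - 2 * υ) / 4 + 2 * ζ = 2 * (υ / 4 + ζ + 1 / 8) by ring,
      show 1 - (4 - 2 - 2 * υ) / 4 + 2 * ζ = 2 * (υ / 4 + ζ + 1 / 4) by ring,
      show 1 - (4 - 3 - 2 * υ) / 4 + 2 * ζ = 2 * (υ / 4 + ζ + 3 / 8) by ring,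
      show (1 : ℂ) - 1 / 2 + 2 * ζ = 2 * (ζ + 1 / 4) by ring]
    ring
  have e8 : meijerIntegrand (upper8 υ) [] [0, 1 / 2] [1 / 4, 3 / 4] (log8 y w) ζ =
      (Complex.Gamma (-ζ) * Complex.Gamma (-ζ + 1 / 2)) *
        ((Complex.Gamma (υ / 4 + ζ) * Complex.Gamma (υ / 4 + ζ + 1 / 2)) *
        (Complex.Gamma (υ / 4 + ζ + 1 / 8) * Complex.Gamma (υ / 4 + ζ + 1 / 8 + 1 / 2)) *
        (Complex.Gamma (υ / 4 + ζ + 1 / 4) * Complex.Gamma (υ / 4 + ζ + 1 / 4 + 1 / 2)) *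
        (Complex.Gamma (υ / 4 + ζ + 3 / 8) * Complex.Gamma (υ / 4 + ζ + 3 / 8 + 1 / 2))) /
        (Complex.Gamma (ζ + 1 / 4) * Complex.Gamma (ζ + 1 / 4 + 1 / 2)) *
      Complex.exp (ζ * log8 y w) := by
    simp only [meijerIntegrand, upper8, List.map_cons, List.map_nil, List.prod_cons, List.prod_nil,
      mul_one]
    rw [show (0 : ℂ) - ζ = -ζ by ring, show (1 : ℂ) / 2 - ζ = -ζ + 1 / 2 by ring,
      show 1 - (8 - 2 * υ) / 8 + ζ = υ / 4 + ζ by ring,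
      show 1 - (7 - 2 * υ) / 8 + ζ = υ / 4 + ζ + 1 / 8 by ring,
      show 1 - (6 - 2 * υ) / 8 + ζ = υ / 4 + ζ + 1 / 4 by ring,
      show 1 - (5 - 2 * υ) / 8 + ζ = υ / 4 + ζ + 3 / 8 by ring,
      show 1 - (4 - 2 * υ) / 8 + ζ = υ / 4 + ζ + 1 / 2 by ring,
      show 1 - (3 - 2 * υ) / 8 + ζ = υ / 4 + ζ + 1 / 8 + 1 / 2 by ring,
      show 1 - (2 - 2 * υ) / 8 + ζ = υ / 4 + ζ + 1 / 4 + 1 / 2 by ring,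
      show 1 - (1 - 2 * υ) / 8 + ζ = υ / 4 + ζ + 3 / 8 + 1 / 2 by ring,
      show (1 : ℂ) - 1 / 4 + ζ = ζ + 1 / 4 + 1 / 2 by ring,
      show (1 : ℂ) - 3 / 4 + ζ = ζ + 1 / 4 by ring]
    ring
  rw [e8, e4, h1, h2, h3, h4, h5, h6, exp_mul_log8 hy, ← sqrt_pi_sq]
  have h2p : (2 : ℂ) ^ (3 - 2 * υ) = (2 : ℂ) ^ (1 - 2 * -ζ) * ((2 : ℂ) ^ (1 - 2 * (υ / 4 + ζ)) *
      (2 : ℂ) ^ (1 - 2 * (υ / 4 + ζ + 1 / 8)) * (2 : ℂ) ^ (1 - 2 * (υ / 4 + ζ + 1 / 4)) *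
      (2 : ℂ) ^ (1 - 2 * (υ / 4 + ζ + 3 / 8))) * (2 : ℂ) ^ (-(1 - 2 * (ζ + 1 / 4))) *
      (2 : ℂ) ^ (4 * ζ) := by
    simp only [← Complex.cpow_add _ _ two_ne_zero]
    congr 1
    ring
  rw [h2p, Complex.cpow_neg]
  simp only [div_eq_mul_inv, mul_inv]
  field_simp

/-! ### Evaluation of the G-functions -/

/-- The cosine transform of `x ^ (υ - 1) * exp (-w √x)` at `y`. -/
noncomputable def cosSqrt (υ w : ℂ) (y : ℝ) : ℂ :=
  ∫ x : ℝ in Ioi 0, (x : ℂ) ^ (υ - 1) * Complex.exp (-w * (Real.sqrt x : ℂ)) *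
    (Real.cos (x * y) : ℂ)

/-- The first upper parameter has the largest real part, so it alone fixes the left end of the
strip. -/
theorem separatesPoles_upper4 (N υ β : ℂ) (σ : ℝ) :
    SeparatesPoles (upper4 N υ) [β] σ ↔ σ ∈ Ioo ((N.re - 2 * υ.re) / 4 - 1) β.re := by
  simp [SeparatesPoles, upper4]
  constructor
  · rintro ⟨h1, h2, -⟩
    exact ⟨by linarith, h1⟩
  · rintro ⟨h1, h2⟩
    refine ⟨h2, ?_, ?_, ?_, ?_⟩ <;> linarith

theorem separatesPoles_upper8 (υ : ℂ) (σ : ℝ) :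
    SeparatesPoles (upper8 υ) [0, 1 / 2] σ ↔ σ ∈ Ioo (-(υ.re / 4)) 0 := by
  simp [SeparatesPoles, upper8]
  constructor
  · rintro ⟨⟨h1, -⟩, h2, -⟩
    exact ⟨by linarith, h1⟩
  · rintro ⟨h1, h2⟩
    refine ⟨⟨h2, ?_⟩, ?_, ?_, ?_, ?_, ?_, ?_, ?_, ?_⟩ <;> linarith

theorem hasLineIntegral_meijerIntegrand_upper4 {υ w : ℂ} {y : ℝ} (hw : 0 < w.re) (hy : 0 < y) :
    HasLineIntegral (Ioo (-(υ.re / 2)) 0)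
      (meijerIntegrand (upper4 4 υ) [] [0] [1 / 2] (log4 y w))
      (Real.pi * (2 : ℂ) ^ (7 / 2 - 4 * υ) * w ^ (2 * υ) * (cosSqrt υ w y / (4 : ℝ))) := by
  have hw0 : w ≠ 0 := by rintro rfl; simp at hw
  refine (hasLineIntegral_cosBarnes hw hy).comp_affine (m := 4) (by norm_num) (2 * υ) _ ?_ ?_
  · rintro σ ⟨h1, h2⟩
    constructor <;> simp <;> linarith
  · rintro σ ⟨h1, h2⟩ ζ rfl
    rw [meijerIntegrand_upper4_eq hw0 hy (by linarith)]
    norm_num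

/-- All parameters are those of the case `N = 4` moved by `δ`; the strip of separating lines moves
by `Re δ` and keeps its width `Re υ / 2`. -/
theorem meijerG_upper4_shift {υ w : ℂ} {y : ℝ} (hυ : 0 < υ.re) (hw : 0 < w.re) (hy : 0 < y)
    (δ N β₁ β₂ : ℂ) (hN : N = 4 + 4 * δ) (h₁ : β₁ = δ) (h₂ : β₂ = 1 / 2 + δ) :
    MeijerGConverges (upper4 N υ) [] [β₁] [β₂] (log4 y w) ∧
      G42 N υ β₁ β₂ y w = Complex.exp (δ * log4 y w) *
        (Real.pi * (2 : ℂ) ^ (7 / 2 - 4 * υ) * w ^ (2 * υ) * (cosSqrt υ w y / 4)) := by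
  subst hN h₁ h₂
  have h := ((hasLineIntegral_meijerIntegrand_upper4 (υ := υ) hw hy).comp_affine
    (S' := Ioo ((4 + 4 * β₁.re - 2 * υ.re) / 4 - 1) β₁.re)
    (f := meijerIntegrand (upper4 (4 + 4 * β₁) υ) [] [β₁] [1 / 2 + β₁] (log4 y w)) one_pos
    (-β₁) (Complex.exp (β₁ * log4 y w)) ?_ ?_).meijer
    (fun σ => by simpa using separatesPoles_upper4 (4 + 4 * β₁) υ β₁ σ) (nonempty_Ioo.2 (by linarith))
  · simpa [G42] using h
  · rintro σ ⟨h1, h2⟩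
    constructor <;> simp <;> linarith
  · rintro σ - ζ -
    have e := meijerIntegrand_map_add (upper4 4 υ) [] [0] [1 / 2] β₁ (log4 y w) ζ
    have hu : (upper4 4 υ).map (· + β₁) = upper4 (4 + 4 * β₁) υ := by
      simp only [upper4, List.map_cons, List.map_nil, List.cons.injEq, and_true]
      refine ⟨?_, ?_, ?_, ?_⟩ <;> ring
    rw [hu] at e
    simpa [sub_eq_add_neg] using e

theorem meijerG_upper8 {υ w : ℂ} {y : ℝ} (hυ : 0 < υ.re) (hw : 0 < w.re) (hy : 0 < y) :
    MeijerGConverges (upper8 υ) [] [0, 1 / 2] [1 / 4, 3 / 4] (log8 y w) ∧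
      G84 υ y w = Real.pi ^ 2 * (2 : ℂ) ^ (3 - 2 * υ) *
        (Real.pi * (2 : ℂ) ^ (7 / 2 - 4 * υ) * w ^ (2 * υ) * (cosSqrt υ w y / 4) / 2) := by
  have h := ((hasLineIntegral_meijerIntegrand_upper4 (υ := υ) hw hy).comp_affine
    (S' := Ioo (-(υ.re / 4)) 0)
    (f := meijerIntegrand (upper8 υ) [] [0, 1 / 2] [1 / 4, 3 / 4] (log8 y w)) two_pos
    0 (Real.pi ^ 2 * (2 : ℂ) ^ (3 - 2 * υ)) ?_ ?_).meijer
    (separatesPoles_upper8 υ) (nonempty_Ioo.2 (by linarith))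
  · simpa [G84] using h
  · rintro σ ⟨h1, h2⟩
    constructor <;> simp <;> linarith
  · rintro σ - ζ -
    simpa using meijerIntegrand_upper8_eq hy ζ

/-- The cosine transform in terms of the G-function with parameters shifted by `δ`. -/
theorem mul_meijerG_upper4_div {υ w P N e β₁ β₂ : ℂ} {y : ℝ} (hυ : 0 < υ.re) (hw : 0 < w.re)
    (hy : 0 < y) (δ : ℂ) (hN : N = 4 + 4 * δ) (h₁ : β₁ = δ) (h₂ : β₂ = 1 / 2 + δ)
    (he : e = 2 * υ - 4 * δ)
    (hP : P = (2 : ℂ) ^ (4 * υ - 3 / 2 - 6 * δ) / Real.pi * (y : ℂ) ^ (-(2 * δ))) :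
    P * (G42 N υ β₁ β₂ y w / w ^ e) = cosSqrt υ w y := by
  have hw0 : w ≠ 0 := by rintro rfl; simp at hw
  have hy0 : (y : ℂ) ≠ 0 := by exact_mod_cast hy.ne'
  have hpi : (Real.pi : ℂ) ≠ 0 := by exact_mod_cast Real.pi_pos.ne'
  have hwe : w ^ e ≠ 0 := by simp [Complex.cpow_eq_zero_iff, hw0]
  have hy2 : (y : ℂ) ^ (2 * δ) ≠ 0 := by simp [Complex.cpow_eq_zero_iff, hy0]
  have hwp : w ^ (-(4 * δ)) * w ^ (2 * υ) = w ^ e := by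
    rw [← Complex.cpow_add _ _ hw0, he]; congr 1; ring
  -- The remaining `2^2` cancels the Jacobian `1/4` of `s = 4ζ + 2υ`.
  have h2p : (2 : ℂ) ^ (4 * υ - 3 / 2 - 6 * δ) * (2 : ℂ) ^ (6 * δ) * (2 : ℂ) ^ (7 / 2 - 4 * υ) = 4 := by
    rw [← Complex.cpow_add _ _ two_ne_zero, ← Complex.cpow_add _ _ two_ne_zero,
      show 4 * υ - 3 / 2 - 6 * δ + 6 * δ + (7 / 2 - 4 * υ) = (2 : ℕ) by push_cast; ring,
      Complex.cpow_natCast]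
    norm_num
  rw [(meijerG_upper4_shift hυ hw hy δ N β₁ β₂ hN h₁ h₂).2, exp_mul_log4 hy hw0, hP,
    Complex.cpow_neg]
  calc _ = ((2 : ℂ) ^ (4 * υ - 3 / 2 - 6 * δ) * (2 : ℂ) ^ (6 * δ) * (2 : ℂ) ^ (7 / 2 - 4 * υ)) *
        (w ^ (-(4 * δ)) * w ^ (2 * υ) / w ^ e) * ((y : ℂ) ^ (2 * δ) / (y : ℂ) ^ (2 * δ)) *
        (Real.pi / Real.pi) * (cosSqrt υ w y / 4) := by ring
    _ = _ := by
        rw [h2p, hwp, div_self hwe, div_self hy2, div_self hpi]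
        ring

theorem mul_meijerG_upper8_div {υ w : ℂ} {y : ℝ} (hυ : 0 < υ.re) (hw : 0 < w.re) (hy : 0 < y) :
    (2 : ℂ) ^ (6 * υ - 7 / 2) / (Real.pi : ℂ) ^ 3 * (G84 υ y w / w ^ (2 * υ)) = cosSqrt υ w y := by
  have hw0 : w ≠ 0 := by rintro rfl; simp at hw
  have hpi : (Real.pi : ℂ) ≠ 0 := by exact_mod_cast Real.pi_pos.ne'
  have hwe : w ^ (2 * υ) ≠ 0 := by simp [Complex.cpow_eq_zero_iff, hw0]
  -- The remaining `2^3` cancels the Jacobians `1/4` and `1/2`.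
  have h2p : (2 : ℂ) ^ (6 * υ - 7 / 2) * (2 : ℂ) ^ (3 - 2 * υ) * (2 : ℂ) ^ (7 / 2 - 4 * υ) = 8 := by
    rw [← Complex.cpow_add _ _ two_ne_zero, ← Complex.cpow_add _ _ two_ne_zero,
      show 6 * υ - 7 / 2 + (3 - 2 * υ) + (7 / 2 - 4 * υ) = (3 : ℕ) by push_cast; ring,
      Complex.cpow_natCast]
    norm_num
  rw [(meijerG_upper8 hυ hw hy).2]
  calc _ = ((2 : ℂ) ^ (6 * υ - 7 / 2) * (2 : ℂ) ^ (3 - 2 * υ) * (2 : ℂ) ^ (7 / 2 - 4 * υ)) *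
        (w ^ (2 * υ) / w ^ (2 * υ)) * (Real.pi / Real.pi) ^ 3 * (cosSqrt υ w y / 8) := by ring
    _ = _ := by
        rw [h2p, div_self hwe, div_self hpi]
        ring

/-! ### Termwise integration and the G-function series -/

theorem summable_and_eq_of_termwise {Θ E G T : ℕ → ℂ} {P I : ℂ} (hP : P ≠ 0)
    (h : ∀ k, P * (G k / E k) = T k) (hs : Summable fun k => Θ k / (k.factorial : ℂ) * T k)
    (hI : I = ∑' k, Θ k / (k.factorial : ℂ) * T k) :
    (Summable fun k => Θ k / ((k.factorial : ℂ) * E k) * G k) ∧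
      I = P * ∑' k, Θ k / ((k.factorial : ℂ) * E k) * G k := by
  have e : (fun k => Θ k / (k.factorial : ℂ) * T k) =
      fun k => P * (Θ k / ((k.factorial : ℂ) * E k) * G k) := by
    funext k
    rw [← h k, ← div_div]
    ring
  rw [e] at hs hI
  exact ⟨(summable_mul_left_iff hP).1 hs, by rw [hI, tsum_mul_left]⟩

/-- The G-function series follow from the termwise cosine transforms. -/
theorem hasGSeries_of_termwise {Θ : ℕ → ℂ} {υ b c lam I : ℂ} {y : ℝ} (hy : 0 < y) (hυ : 0 < υ.re)
    (hw : ∀ k : ℕ, 0 < (lam * b + c * k).re)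
    (hs : Summable fun k : ℕ => Θ k / (k.factorial : ℂ) * cosSqrt υ (lam * b + c * k) y)
    (hI : I = ∑' k : ℕ, Θ k / (k.factorial : ℂ) * cosSqrt υ (lam * b + c * k) y) :
    HasGSeries Θ υ b c lam y I := by
  have hy0 : (y : ℂ) ≠ 0 := by exact_mod_cast hy.ne'
  have hpi : (Real.pi : ℂ) ≠ 0 := by exact_mod_cast Real.pi_pos.ne'
  have hsq : (Real.sqrt y : ℂ) ≠ 0 := by exact_mod_cast (Real.sqrt_pos.2 hy).ne'
  have h2 : ∀ z : ℂ, (2 : ℂ) ^ z ≠ 0 := fun z => by simp [Complex.cpow_eq_zero_iff]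
  have c1 := summable_and_eq_of_termwise (P := (2 : ℂ) ^ (4 * υ - 3 / 2) / (Real.pi : ℂ))
    (div_ne_zero (h2 _) hpi)
    (fun k => mul_meijerG_upper4_div (N := 4) (e := 2 * υ) (β₁ := 0) (β₂ := 1 / 2) hυ (hw k) hy 0
      (by simp) rfl (by simp) (by simp) (by simp)) hs hI
  have c2 := summable_and_eq_of_termwise
    (P := (Real.sqrt y : ℂ) * (2 : ℂ) ^ (4 * υ) / (Real.pi : ℂ))
    (div_ne_zero (mul_ne_zero hsq (h2 _)) hpi)
    (fun k => mul_meijerG_upper4_div (N := 3) (e := 2 * υ + 1) (β₁ := -1 / 4) (β₂ := 1 / 4) hυ (hw k)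
      hy (-1 / 4) (by norm_num) rfl (by norm_num) (by ring) (by
        rw [Real.sqrt_eq_rpow, Complex.ofReal_cpow hy.le,
          show 4 * υ - 3 / 2 - 6 * (-1 / 4) = 4 * υ by ring,
          show -(2 * (-1 / 4 : ℂ)) = ((1 / 2 : ℝ) : ℂ) by push_cast; norm_num]
        ring)) hs hI
  have c3 := summable_and_eq_of_termwise
    (P := (2 : ℂ) ^ (4 * υ - 9 / 2) / ((Real.pi : ℂ) * (y : ℂ)))
    (div_ne_zero (h2 _) (mul_ne_zero hpi hy0))
    (fun k => mul_meijerG_upper4_div (N := 6) (e := 2 * υ - 2) (β₁ := 1 / 2) (β₂ := 1) hυ (hw k)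
      hy (1 / 2) (by norm_num) rfl (by norm_num) (by ring) (by
        rw [show 4 * υ - 3 / 2 - 6 * (1 / 2) = 4 * υ - 9 / 2 by ring,
          show -(2 * (1 / 2 : ℂ)) = -1 by norm_num, Complex.cpow_neg_one]
        field_simp)) hs hI
  have c4 := summable_and_eq_of_termwise
    (P := (y : ℂ) * (2 : ℂ) ^ (4 * υ + 3 / 2) / (Real.pi : ℂ))
    (div_ne_zero (mul_ne_zero hy0 (h2 _)) hpi)
    (fun k => mul_meijerG_upper4_div (N := 2) (e := 2 * υ + 2) (β₁ := -1 / 2) (β₂ := 0) hυ (hw k)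
      hy (-1 / 2) (by norm_num) rfl (by norm_num) (by ring) (by
        rw [show 4 * υ - 3 / 2 - 6 * (-1 / 2) = 4 * υ + 3 / 2 by ring,
          show -(2 * (-1 / 2 : ℂ)) = 1 by norm_num, Complex.cpow_one]
        ring)) hs hI
  have c5 := summable_and_eq_of_termwise
    (P := (2 : ℂ) ^ (6 * υ - 7 / 2) / (Real.pi : ℂ) ^ 3)
    (div_ne_zero (h2 _) (pow_ne_zero _ hpi))
    (fun k => mul_meijerG_upper8_div hυ (hw k) hy) hs hI
  exact
    { integrable_term := fun k => integrableOn_cpow_mul_exp_neg_sqrt_mul hυ (hw k)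
        (by fun_prop) fun x _ => by
          rw [Complex.norm_real]
          exact Real.abs_cos_le_one _
      summable_termwise := hs
      eq_termwise := hI
      converges₁ := fun k => (meijerG_upper4_shift hυ (hw k) hy 0 4 0 (1 / 2) (by simp) rfl
        (by simp)).1
      summable₁ := c1.1
      eq₁ := c1.2
      converges₂ := fun k => (meijerG_upper4_shift hυ (hw k) hy (-1 / 4) 3 (-1 / 4) (1 / 4)
        (by norm_num) rfl (by norm_num)).1
      summable₂ := c2.1
      eq₂ := c2.2
      converges₃ := fun k => (meijerG_upper4_shift hυ (hw k) hy (1 / 2) 6 (1 / 2) 1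
        (by norm_num) rfl (by norm_num)).1
      summable₃ := c3.1
      eq₃ := c3.2
      converges₄ := fun k => (meijerG_upper4_shift hυ (hw k) hy (-1 / 2) 2 (-1 / 2) 0
        (by norm_num) rfl (by norm_num)).1
      summable₄ := c4.1
      eq₄ := c4.2
      converges₅ := fun k => (meijerG_upper8 hυ (hw k) hy).1
      summable₅ := c5.1
      eq₅ := c5.2 }

/-- The sum is an a.e. limit of measurable partial sums, and Tonelli bounds its absolute integral by
the sum of those of the terms. -/
theorem integrable_tsum_of_summable_integral_norm {α E : Type*} [MeasurableSpace α]
    [NormedAddCommGroup E] {μ : Measure α} {F : ℕ → α → E} {f : α → E}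
    (hF : ∀ k, Integrable (F k) μ) (hs : Summable fun k => ∫ a, ‖F k a‖ ∂μ)
    (hf : ∀ᵐ a ∂μ, HasSum (fun k => F k a) (f a)) : Integrable f μ := by
  refine ⟨aestronglyMeasurable_of_tendsto_ae atTop (f := fun n a => ∑ k ∈ Finset.range n, F k a)
    (fun n => (integrable_finsetSum _ fun k _ => hF k).aestronglyMeasurable)
    (hf.mono fun a ha => ha.tendsto_sum_nat), ?_⟩
  rw [hasFiniteIntegral_iff_enorm]
  calc ∫⁻ a, ‖f a‖ₑ ∂μ ≤ ∫⁻ a, ∑' k, ‖F k a‖ₑ ∂μ := by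
        refine lintegral_mono_ae (hf.mono fun a ha => ?_)
        rw [← ha.tsum_eq]
        exact enorm_tsum_le_tsum_enorm
    _ = ∑' k, ENNReal.ofReal (∫ a, ‖F k a‖ ∂μ) := by
        rw [lintegral_tsum fun k => (hF k).aestronglyMeasurable.enorm]
        exact tsum_congr fun k => (ofReal_integral_norm_eq_lintegral_enorm (hF k)).symm
    _ < ⊤ := hs.tsum_ofReal_lt_top

theorem integral_rpow_mul_exp_neg_sqrt {a r : ℝ} (ha : 0 < a) (hr : 0 < r) :
    ∫ x : ℝ in Ioi 0, x ^ (a - 1) * Real.exp (-r * Real.sqrt x) =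
      r ^ (-(2 * a)) * (2 * Real.Gamma (2 * a)) := by
  have h := integral_rpow_mul_exp_neg_mul_rpow (p := 1 / 2) (q := a - 1) (b := r) (by norm_num)
    (by linarith) hr
  simp only [Real.sqrt_eq_rpow]
  rw [h, show -(a - 1 + 1) / (1 / 2) = -(2 * a) by ring, show (a - 1 + 1) / (1 / 2) = 2 * a by ring]
  ring

section series

variable {Θ : ℕ → ℂ} {υ c : ℂ}

/-- The exponential `exp (-m k)` is eventually below any multiple of `(k+1)^(-p)`, so the
convergence condition implies convergence of the kernel series at every `x > 0`. -/
theorem summable_norm_mul_exp_neg_pow {p m : ℝ} (hm : 0 < m)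
    (hΘ : Summable fun k : ℕ => ‖Θ k‖ / ((k.factorial : ℝ) * ((k : ℝ) + 1) ^ p)) :
    Summable fun k : ℕ => ‖Θ k‖ / (k.factorial : ℝ) * Real.exp (-m) ^ k := by
  have hcast : Tendsto (fun k : ℕ => (k : ℝ) + 1) atTop atTop :=
    tendsto_atTop_add_const_right _ _ tendsto_natCast_atTop_atTop
  have h1 : (fun k : ℕ => Real.exp (-m * ((k : ℝ) + 1))) =O[atTop]
      fun k : ℕ => ((k : ℝ) + 1) ^ (-p) :=
    ((isLittleO_exp_neg_mul_rpow_atTop hm (-p)).comp_tendsto hcast).isBigO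
  refine summable_of_isBigO_nat hΘ ?_
  have h2 := (Asymptotics.isBigO_refl (fun k : ℕ => ‖Θ k‖ / (k.factorial : ℝ)) atTop).mul
    (h1.const_mul_left (Real.exp m))
  refine h2.congr (fun k => ?_) fun k => ?_
  · rw [← Real.exp_add, ← Real.exp_nat_mul]
    congr 2
    ring
  · rw [Real.rpow_neg (by positivity), ← div_eq_mul_inv, div_div]

theorem summable_kernel {p : ℝ} (hc : 0 < c.re)
    (hΘ : Summable fun k : ℕ => ‖Θ k‖ / ((k.factorial : ℝ) * ((k : ℝ) + 1) ^ p))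
    {x : ℝ} (hx : 0 < x) :
    Summable fun k : ℕ => Θ k / (k.factorial : ℂ) * Complex.exp (-c * (Real.sqrt x : ℂ)) ^ k := by
  refine Summable.of_norm ?_
  refine (summable_norm_mul_exp_neg_pow (mul_pos hc (Real.sqrt_pos.2 hx)) hΘ).congr fun k => ?_
  rw [norm_mul, norm_div, norm_pow, Complex.norm_exp, Complex.norm_natCast]
  simp

/-- A kernel given by a series in `exp (-c √x)` is integrated term by term. -/
theorem transformHasGSeries_of_summable {b lam : ℂ} {y : ℝ} {K : ℝ → ℂ} (hy : 0 < y)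
    (hυ : 0 < υ.re) (hc : 0 < c.re) (hlb : 0 < (lam * b).re)
    (hΘ : Summable fun k : ℕ => ‖Θ k‖ / ((k.factorial : ℝ) * ((k : ℝ) + 1) ^ (2 * υ.re)))
    (hK : ∀ x, 0 < x → K x =
      ∑' k : ℕ, Θ k / (k.factorial : ℂ) * Complex.exp (-c * (Real.sqrt x : ℂ)) ^ k) :
    TransformHasGSeries Θ K υ b c lam y := by
  have hsum : ∀ x : ℝ, 0 < x → HasSum (fun k : ℕ =>
      Θ k / (k.factorial : ℂ) * Complex.exp (-c * (Real.sqrt x : ℂ)) ^ k) (K x) := fun x hx => by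
    rw [hK x hx]
    exact (summable_kernel hc hΘ hx).hasSum
  -- This `m` gives `Re w_k ≥ m (k + 1)`, turning the exact value `2 Γ(2 Re υ) (Re w_k)^(-2 Re υ)`
  -- of the majorant integral into the weight in `hΘ`.
  set m : ℝ := min (lam * b).re c.re with hm
  have hm0 : 0 < m := lt_min hlb hc
  have hwm : ∀ k : ℕ, m * ((k : ℝ) + 1) ≤ (lam * b + c * k).re := fun k => by
    have h1 : m ≤ (lam * b).re := min_le_left _ _
    have h2 : m * k ≤ c.re * k := mul_le_mul_of_nonneg_right (min_le_right _ _) k.cast_nonneg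
    have h3 : (lam * b + c * k).re = (lam * b).re + c.re * k := by simp
    rw [h3]
    linarith
  have hw : ∀ k : ℕ, 0 < (lam * b + c * k).re := fun k => lt_of_lt_of_le (by positivity) (hwm k)
  set F : ℕ → ℝ → ℂ := fun k x => Θ k / (k.factorial : ℂ) * ((x : ℂ) ^ (υ - 1) *
    Complex.exp (-(lam * b + c * k) * (Real.sqrt x : ℂ)) * (Real.cos (x * y) : ℂ)) with hF
  have hcos : ∀ x : ℝ, ‖(Real.cos (x * y) : ℂ)‖ ≤ 1 := fun x => by
    rw [Complex.norm_real]
    exact Real.abs_cos_le_one _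
  have hFi : ∀ k, IntegrableOn (F k) (Ioi 0) := fun k =>
    (integrableOn_cpow_mul_exp_neg_sqrt_mul hυ (hw k) (by fun_prop) fun x _ => hcos x).const_mul _
  have hFs : Summable fun k => ∫ x in Ioi 0, ‖F k x‖ := by
    refine Summable.of_nonneg_of_le (fun k => integral_nonneg fun x => norm_nonneg _) (fun k => ?_)
      (hΘ.mul_right (m ^ (-(2 * υ.re)) * (2 * Real.Gamma (2 * υ.re))))
    have hpos : (0 : ℝ) < (k : ℝ) + 1 := by positivity
    calc ∫ x in Ioi 0, ‖F k x‖ ≤ ∫ x in Ioi 0, ‖Θ k‖ / (k.factorial : ℝ) *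
          (x ^ (υ.re - 1) * Real.exp (-(lam * b + c * k).re * Real.sqrt x)) := by
          refine setIntegral_mono_on (hFi k).norm
            ((integrableOn_rpow_mul_exp_neg_sqrt hυ (hw k)).const_mul _) measurableSet_Ioi
            fun x hx => ?_
          have hx' : (0 : ℝ) < x := hx
          rw [hF]
          simp only
          rw [norm_mul, norm_mul _ (Real.cos (x * y) : ℂ), norm_cpow_mul_exp_neg_sqrt hx', norm_div,
            Complex.norm_natCast]
          exact mul_le_mul_of_nonneg_left (mul_le_of_le_one_right (by positivity) (hcos x))
            (by positivity)
      _ = ‖Θ k‖ / (k.factorial : ℝ) * ((lam * b + c * k).re ^ (-(2 * υ.re)) *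
          (2 * Real.Gamma (2 * υ.re))) := by
          rw [integral_const_mul, integral_rpow_mul_exp_neg_sqrt hυ (hw k)]
      _ ≤ ‖Θ k‖ / (k.factorial : ℝ) * ((m * ((k : ℝ) + 1)) ^ (-(2 * υ.re)) *
          (2 * Real.Gamma (2 * υ.re))) := by
          have := Real.rpow_le_rpow_of_nonpos (by positivity) (hwm k)
            (show -(2 * υ.re) ≤ 0 by linarith)
          have := Real.Gamma_pos_of_pos (show 0 < 2 * υ.re by linarith)
          gcongr
      _ = _ := by
          rw [Real.mul_rpow hm0.le hpos.le, Real.rpow_neg hpos.le, ← div_div]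
          ring
  have hFsum : ∀ x ∈ Ioi (0 : ℝ), HasSum (fun k => F k x) ((x : ℂ) ^ (υ - 1) *
      Complex.exp (-(b * lam) * (Real.sqrt x : ℂ)) * K x * (Real.cos (x * y) : ℂ)) := by
    intro x hx
    refine (((hsum x hx).mul_left ((x : ℂ) ^ (υ - 1) *
      Complex.exp (-(b * lam) * (Real.sqrt x : ℂ)))).mul_right (Real.cos (x * y) : ℂ)).congr_fun
      fun k => ?_
    have he : Complex.exp (-(lam * b + c * k) * (Real.sqrt x : ℂ)) =
        Complex.exp (-(b * lam) * (Real.sqrt x : ℂ)) *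
          Complex.exp (-c * (Real.sqrt x : ℂ)) ^ k := by
      rw [← Complex.exp_nat_mul, ← Complex.exp_add]
      congr 1
      ring
    simp only [hF, he]
    ring
  have hI := hasSum_integral_of_summable_integral_norm hFi hFs
  have hval : ∫ x in Ioi 0, ∑' k, F k x = cosTransform υ b lam K y :=
    setIntegral_congr_fun measurableSet_Ioi fun x hx => (hFsum x hx).tsum_eq
  have hterm : (fun k => ∫ x in Ioi 0, F k x) =
      fun k : ℕ => Θ k / (k.factorial : ℂ) * cosSqrt υ (lam * b + c * k) y :=
    funext fun k => integral_const_mul _ _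
  rw [hval, hterm] at hI
  exact
    { hasSum_kernel := hsum
      integrable := integrable_tsum_of_summable_integral_norm hFi hFs
        ((ae_restrict_mem measurableSet_Ioi).mono hFsum)
      hasGSeries := hasGSeries_of_termwise hy hυ hw hI.summable hI.tsum_eq.symm }

end series

/-! ### Decay of the reciprocal Gamma function and the special kernels -/

/-- On a horizontal ray, `1 / Γ` decays at least geometrically. -/
theorem exists_norm_inv_Gamma_le (τ : ℝ) :
    ∃ C : ℝ, ∀ z : ℂ, z.im = τ → 2 ≤ z.re →
      ‖(Complex.Gamma z)⁻¹‖ ≤ C * (2 : ℝ) ^ (-z.re) := by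
  have hcont : Continuous fun x : ℝ => (Complex.Gamma (x + τ * Complex.I))⁻¹ :=
    Complex.differentiable_one_div_Gamma.continuous.comp (by fun_prop)
  obtain ⟨M, hM⟩ := (isCompact_Icc (a := (2 : ℝ)) (b := 3)).exists_bound_of_continuousOn
    hcont.continuousOn
  have hM0 : 0 ≤ M := (norm_nonneg _).trans (hM 2 (by norm_num))
  -- Induction on strips of width one: compactness handles `2 ≤ Re z ≤ 3`, where `2^(-Re z) ≥ 1/8`
  -- explains the factor `8`. Beyond, `Γ(z) = (z - 1) Γ(z - 1)` with `|z - 1| ≥ 2` gains a factor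
  -- `1/2` per unit step.
  have key : ∀ n : ℕ, ∀ z : ℂ, z.im = τ → 2 ≤ z.re → z.re ≤ 3 + n →
      ‖(Complex.Gamma z)⁻¹‖ ≤ 8 * M * (2 : ℝ) ^ (-z.re) := by
    intro n
    induction n with
    | zero =>
      intro z hz h2 h3
      have hz' : z = z.re + τ * Complex.I := by rw [← hz, Complex.re_add_im]
      have h := hM z.re ⟨h2, by simpa using h3⟩
      rw [← hz'] at h
      have hp : (2 : ℝ) ^ (-3 : ℝ) ≤ (2 : ℝ) ^ (-z.re) :=
        Real.rpow_le_rpow_of_exponent_le one_le_two (by simp at h3; linarith)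
      have h8 : (2 : ℝ) ^ (-3 : ℝ) = 1 / 8 := by
        rw [Real.rpow_neg zero_le_two]
        norm_num
      rw [h8] at hp
      nlinarith
    | succ n ih =>
      intro z hz h2 h3
      rcases le_or_gt z.re (3 + n) with h | h
      · exact ih z hz h2 h
      · have hre : 2 ≤ (z - 1).re := by
          have : (0 : ℝ) ≤ n := n.cast_nonneg
          simp
          linarith
        have hne : z - 1 ≠ 0 := by
          intro h0
          rw [h0, Complex.zero_re] at hre
          linarith
        have hG := Complex.Gamma_add_one (z - 1) hne
        rw [sub_add_cancel] at hG
        have hi := ih (z - 1) (by simpa using hz) hre (by push_cast at h3; simp; linarith)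
        have hnorm : ‖(z - 1)⁻¹‖ ≤ 1 / 2 := by
          rw [norm_inv, ← one_div]
          exact one_div_le_one_div_of_le two_pos (hre.trans (Complex.re_le_norm _))
        rw [hG, mul_inv, norm_mul]
        calc _ ≤ 1 / 2 * (8 * M * (2 : ℝ) ^ (-(z - 1).re)) :=
              mul_le_mul hnorm hi (norm_nonneg _) (by norm_num)
          _ = _ := by
              rw [show -(z - 1).re = -z.re + 1 by simp; ring, Real.rpow_add_one two_ne_zero]
              ring
  refine ⟨8 * M, fun z hz h2 => ?_⟩
  obtain ⟨n, hn⟩ := exists_nat_ge z.re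
  exact key n z hz h2 (by linarith)

/-- As `a` is real, the points `β + a k` run along one horizontal ray, and the bound there is
geometric with ratio `2^(-a) < 1`. -/
theorem summable_norm_one_div_Gamma {a : ℝ} (ha : 0 < a) (β : ℂ) :
    Summable fun k : ℕ => ‖1 / Complex.Gamma (β + a * k)‖ := by
  obtain ⟨C, hC⟩ := exists_norm_inv_Gamma_le β.im
  have hr : (2 : ℝ) ^ (-a) < 1 := Real.rpow_lt_one_of_one_lt_of_neg one_lt_two (by linarith)
  have hgeo := (summable_geometric_of_lt_one (by positivity) hr).mul_left (C * (2 : ℝ) ^ (-β.re))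
  refine Summable.of_norm_bounded_eventually_nat hgeo ?_
  have hlim : Tendsto (fun k : ℕ => β.re + a * k) atTop atTop :=
    tendsto_atTop_add_const_left _ _ (tendsto_natCast_atTop_atTop.const_mul_atTop ha)
  filter_upwards [hlim.eventually_ge_atTop 2] with k hk
  have h := hC (β + a * k) (by simp) (by simpa using hk)
  rw [norm_norm, one_div]
  refine h.trans_eq ?_
  rw [← Real.rpow_natCast, ← Real.rpow_mul zero_le_two, mul_assoc, ← Real.rpow_add two_pos]
  congr 2
  simp
  ring

theorem summable_norm_div_of_le {Θ : ℕ → ℂ} {f : ℕ → ℝ} {p : ℝ} (hp : 0 ≤ p) (hf : Summable f)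
    (h : ∀ k, ‖Θ k‖ / (k.factorial : ℝ) ≤ f k) :
    Summable fun k : ℕ => ‖Θ k‖ / ((k.factorial : ℝ) * ((k : ℝ) + 1) ^ p) := by
  refine Summable.of_nonneg_of_le (fun k => by positivity) (fun k => ?_) hf
  rw [← div_div]
  exact (div_le_self (by positivity) (Real.one_le_rpow (by simp) hp)).trans (h k)

end RamanujanCosine

theorem corollary1 (υ b c lam : ℂ) (y : ℝ) (hy : 0 < y) (hυ : 0 < υ.re) (hc : 0 < c.re)
    (hsign : (0 < lam.re ∧ 0 < b.re) ∨ (lam.re < 0 ∧ b.re < 0))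
    (hlb : 0 < (lam * b).re) :
    -- the transform with a Fox-Wright kernel
    (∀ (r s : ℕ) (α : Fin r → ℂ) (A : Fin r → ℝ) (β : Fin s → ℂ) (B : Fin s → ℝ),
      (∀ i, A i ≠ 0) → (∀ j, B j ≠ 0) →
      (∀ (i : Fin r) (k n : ℕ), α i + k * (A i : ℂ) ≠ -(n : ℂ)) →
      (Summable fun k : ℕ =>
        ‖foxWrightCoeff α A β B k‖ / ((k.factorial : ℝ) * ((k : ℝ) + 1) ^ (2 * υ.re))) →
      TransformHasGSeries (foxWrightCoeff α A β B)
          (fun x => foxWright α A β B (Complex.exp (-c * (Real.sqrt x : ℂ)))) υ b c lam y ∧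
        HasGSeries (foxWrightCoeff α A β B) υ b c lam y (XiC α A β B υ b c lam y)) ∧
    -- the Wright function
    (∀ (B₁ : ℝ) (β₁ : ℂ), 0 < B₁ →
      TransformHasGSeries (fun k => 1 / Complex.Gamma (β₁ + B₁ * k))
        (fun x => wrightPhi B₁ β₁ (Complex.exp (-c * (Real.sqrt x : ℂ)))) υ b c lam y) ∧
    -- the Wright generalized Bessel function
    (∀ (μ : ℝ) (ν : ℂ), 0 < μ →
      TransformHasGSeries (fun k => (-1) ^ k / Complex.Gamma (ν + 1 + μ * k))
        (fun x => wrightBessel μ ν (-Complex.exp (-c * (Real.sqrt x : ℂ)))) υ b c lam y) ∧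
    -- the Mittag-Leffler function
    (∀ (B₁ : ℝ) (β₁ : ℂ), 0 < B₁ →
      TransformHasGSeries (fun k => (k.factorial : ℂ) / Complex.Gamma (β₁ + B₁ * k))
        (fun x => mittagLeffler B₁ β₁ (Complex.exp (-c * (Real.sqrt x : ℂ)))) υ b c lam y) := by
  have hp : 0 ≤ 2 * υ.re := by linarith
  have hfac : ∀ k : ℕ, (1 : ℝ) ≤ k.factorial := fun k => by exact_mod_cast k.factorial_pos
  refine ⟨fun r s α A β B _ _ _ hΘ => ?_, fun a β ha => ?_, fun μ ν hμ => ?_, fun a β ha => ?_⟩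
  · have h : TransformHasGSeries (foxWrightCoeff α A β B)
        (fun x => foxWright α A β B (Complex.exp (-c * (Real.sqrt x : ℂ)))) υ b c lam y :=
      transformHasGSeries_of_summable hy hυ hc hlb hΘ fun x _ => tsum_congr fun k => by ring
    exact ⟨h, h.hasGSeries⟩
  · refine transformHasGSeries_of_summable hy hυ hc hlb
      (summable_norm_div_of_le hp (summable_norm_one_div_Gamma ha β) fun k =>
        div_le_self (norm_nonneg _) (hfac k)) fun x _ => tsum_congr fun k => by ring
  · refine transformHasGSeries_of_summable hy hυ hc hlb
      (summable_norm_div_of_le hp (summable_norm_one_div_Gamma hμ (ν + 1)) fun k =>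
        (div_le_self (norm_nonneg _) (hfac k)).trans_eq (by simp)) fun x _ =>
        tsum_congr fun k => ?_
    rw [neg_pow]
    ring
  · refine transformHasGSeries_of_summable hy hυ hc hlb
      (summable_norm_div_of_le hp (summable_norm_one_div_Gamma ha β) fun k => ?_) fun x _ =>
        tsum_congr fun k => ?_
    -- Here `Θ k` carries a factor `k!` that cancels the one in the weight, so the decay of `1/Γ`
    -- alone must give summability.
    · have := hfac k
      rw [norm_div, norm_div, Complex.norm_natCast, norm_one]
      refine le_of_eq ?_
      field_simp
    · have : (k.factorial : ℂ) ≠ 0 := by exact_mod_cast k.factorial_ne_zero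
      field_simp
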